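/- **Setting.** Let $\mathcal S$ be a *federated Byzantine quorum system* (FBQS) on a finite set $\mathbf V$ of nodes: each node $v$ has a non-empty set of *slices*, which are sets of nodes containing $v$. A *quorum* is a non-empty $U\subseteq\mathbf V$ that contains a slice of each of its members; a set $B$ is *$v$-blocking* if it meets every slice of $v$. Fix a set of *correct* nodes; the others are faulty. For a set $I$ of nodes, the projected system $\mathcal S|_I$ on $I$ has as slices of $v\in I$ the sets $q\cap I$, $q$ a slice of $v$. Two nodes are *intertwined* in a system if they are correct and every quorum containing the first and every quorum containing the second share a correct node. A set $I$ is *intact* if it is a quorum of $\mathcal S$, all its members are correct, and any two of its members are intertwined in $\mathcal S|_I$. Let $\mathsf{Val}$ be a totally ordered set of values. *Ballots* are the pairs $b=\langle b.n,b.x\rangle$ with $b.n\in\mathbb N^+$, $b.x\in\mathsf{Val}$, ordered lexicographically, and the null ballot $\langle 0,\bot\rangle$, which is the least. Write $b'\prec b$ (below and incompatible) if $b'<b$ and $b'.x\ne b.x$, where $\bot\ne x$ for every $x\in\mathsf{Val}$. **Executions.** A correct node acts in atomic steps. In each step it applies one of its rules or receives one message (one batch) in transit to it; sent messages go to every node,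 itself included. Links are asynchronous, authenticated, and neither create, drop nor duplicate messages, but may reorder them. A faulty node may at any time send any message (batch) to any node. An *execution* is a finite or infinite sequence of such steps from the initial configuration. A rule may be applied whenever its condition holds; no fairness or timing is assumed, and a running timer may expire at any time. The first step of a correct node $v$ is ${\sf propose}(x)$ for an arbitrary value $x$; after ${\sf decide}$ it stops. **CSCP** (consensus over bunched voting). A node $v$ keeps ballots $c$ (the candidate), $h$ (the highest prepared), $m_V,m_R,m_D$, all initially null, finite sets $C_V,C_R,C_D$ of ballots, initially empty, and $\mathit{round}=0$. Messages are ${\tt VOTE}(s)$, ${\tt READY}(s)$ with $s={\rm PREP}\,b$ or $s={\rm CMT}\,b$. Invoking ${\sf prepare}(b)$: if $m_V<b$, set $m_V:=b$ and send ${\tt VOTE}({\rm PREP}\,b)$. Invoking ${\sf commit}(b)$: if $b\notin C_V$ and $m_V=b$, add $b$ to $C_V$ and send ${\tt VOTE}({\rm CMT}\,b)$. Say that a set $W$ *supports $b$ with ${\tt M}$* if from every $u\in W$ the node has received some ${\tt M}({\rm PREP}\,b_u)$ such that every $b'\prec b$ satisfies $b'\prec b_u$. Rules: 1. ${\sf propose}(x)$: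 $c:=\langle1,x\rangle$; ${\sf prepare}(c)$. 2. If there is a maximum $b>m_R$ supported with ${\tt VOTE}$ by some quorum containing $v$, or a maximum $b>m_R$ supported with ${\tt READY}$ by some $v$-blocking set: $m_R:=b$; send ${\tt READY}({\rm PREP}\,b)$. 3. If there is a maximum $b>m_D$ supported with ${\tt READY}$ by some quorum containing $v$: $m_D:=b$; trigger ${\sf prepared}(b)$; then, if $h<b$, set $h:=b$ and, if moreover $c\le h$, set $c:=h$ and invoke ${\sf commit}(c)$. 4. If $b\notin C_R$ and ${\tt VOTE}({\rm CMT}\,b)$ was received from all members of a quorum containing $v$, or ${\tt READY}({\rm CMT}\,b)$ from all members of a $v$-blocking set: add $b$ to $C_R$; send ${\tt READY}({\rm CMT}\,b)$. 5. If $b\notin C_D$ is non-null and ${\tt READY}({\rm CMT}\,b)$ was received from all members of a quorum containing $v$: add $b$ to $C_D$; trigger ${\sf committed}(b)$ and ${\sf decide}(b.x)$. 6. If there are a quorum $U\ni v$ and ballots $b_u$ ($u\in U$) with $b_u.n>\mathit{round}$ such that a ${\tt VOTE}$ or ${\tt READY}$ message for ${\rm PREP}\,b_u$ or ${\rm CMT}\,b_u$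 was received from each $u\in U$: $\mathit{round}:=\min_{u\in U}b_u.n$; start the timer. 7. On ${\sf timeout}$: $c:=\langle\mathit{round}+1,y\rangle$ with $y=c.x$ if $h$ is null and $y=h.x$ otherwise; ${\sf prepare}(c)$. **ASCP** (consensus over one instance of federated voting per ballot). A node keeps $c,h,\mathit{round}$ as above and, for each ballot $b$, Booleans ${\sf voted}_b,{\sf readied}_b,{\sf delivered}_b$, initially false. Messages are ${\tt VOTE}(b,a)$, ${\tt READY}(b,a)$ with $a$ a Boolean; they are sent and received in batches, that is, possibly infinite collections (taken in ascending ballot order) handled at once, and one step may apply a rule of federated voting to many ballots. Federated voting for $b$: invoking ${\sf vote}(b,a)$ sends ${\tt VOTE}(b,a)$ and sets ${\sf voted}_b$, unless it is already set; if ${\sf readied}_b$ is not set and ${\tt VOTE}(b,a)$ was received from all members of a quorum containing $v$, or ${\tt READY}(b,a)$ from all members of a $v$-blocking set, the node sets ${\sf readied}_b$ and sends ${\tt READY}(b,a)$; if ${\sf delivered}_b$ is not set and ${\tt READY}(b,a)$ was received from all members of a quorum containing $v$, it sets ${\sf delivered}_b$ and triggers ${\sf deliver}(b,a)$. Rules: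 1. ${\sf propose}(x)$: $c:=\langle1,x\rangle$; ${\sf vote}(b',{\rm false})$ for all $b'\prec c$. 2. If ${\sf deliver}(b',{\rm false})$ was triggered for every $b'\prec b$, and $h<b$: $h:=b$ and, if $c\le h$, then $c:=h$ and ${\sf vote}(c,{\rm true})$. 3. On ${\sf deliver}(b,{\rm true})$ with $b$ non-null: ${\sf decide}(b.x)$. 4. If there are a quorum $U\ni v$ and ballots $b_u$ ($u\in U$) with $b_u.n>\mathit{round}$ such that, for each $u\in U$ and some ${\tt M}_u\in\{{\tt VOTE},{\tt READY}\}$, either ${\tt M}_u(b_u,{\rm true})$ was received from $u$, or for some $z_u<b_u$ all of ${\tt M}_u(b',{\rm false})$, $z_u\le b'<b_u$, were received from $u$: $\mathit{round}:=\min_{u\in U}b_u.n$; start the timer. 5. On ${\sf timeout}$: $c:=\langle\mathit{round}+1,y\rangle$ with $y=c.x$ if $h$ is null and $y=h.x$ otherwise; ${\sf vote}(b',{\rm false})$ for all $b'\prec c$. **Traces and histories.** The *trace* of an execution is the sequence of the events of correct nodes in it: proposals, decisions, the starting and expiry of timers, the invocations and indications of the voting layer, and the sending and receiving of messages (for ASCP,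 the events of voting, delivering, sending and receiving are batched). The projection $\tau|_I$ of a trace removes the events of nodes outside $I$. The *history* $H(\tau)$ of a trace removes all events other than $v.{\sf propose}(x)$ and $v.{\sf decide}(x)$. **Theorem.** Let $\mathcal S$ be an FBQS and $I$ an intact set. For every execution of CSCP over $\mathcal S$, with trace $\tau$, there is an execution of ASCP over $\mathcal S$ with the same set of correct nodes, with trace $\rho$, such that $$H(\tau|_I)=H(\rho|_I).$$ -/

import Mathlib

namespace SCP

universe u v

/-! ### Federated Byzantine quorum systems -/

/-- A federated Byzantine quorum system: every node has a non-empty set of quorum slices and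
belongs to all of its own slices. -/
structure FBQS (V : Type u) where
  slices : V → Set (Set V)
  slices_nonempty : ∀ v, (slices v).Nonempty
  self_mem : ∀ v, ∀ q ∈ slices v, v ∈ q

namespace FBQS

variable {V : Type u}

/-- A quorum is a non-empty set of nodes that contains a slice of each of its members. -/
def IsQuorum (S : FBQS V) (U : Set V) : Prop :=
  U.Nonempty ∧ ∀ w ∈ U, ∃ q ∈ S.slices w, q ⊆ U

/-- `B` is `w`-blocking when it overlaps every slice of `w`. -/
def IsBlocking (S : FBQS V) (w : V) (B : Set V) : Prop :=
  ∀ q ∈ S.slices w, (q ∩ B).Nonempty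

/-- The projection of the system to the universe `I`: the slices of a node of `I` are the sets
`q ∩ I`, for `q` one of its slices. -/
def project (S : FBQS V) (I : Set V) : FBQS I where
  slices w := (fun q : Set V => ((↑) : I → V) ⁻¹' q) '' S.slices w
  slices_nonempty w := (S.slices_nonempty w).image _
  self_mem := by
    rintro w _ ⟨q, hq, rfl⟩
    exact S.self_mem w q hq

/-- Two nodes are intertwined, for the set `ok` of correct nodes, when they are correct and every
quorum of the first meets every quorum of the second in a correct node. -/
def Intertwined (S : FBQS V) (ok : Set V) (v₁ v₂ : V) : Prop :=
  v₁ ∈ ok ∧ v₂ ∈ ok ∧ ∀ U₁ U₂ : Set V, S.IsQuorum U₁ → S.IsQuorum U₂ → v₁ ∈ U₁ → v₂ ∈ U₂ →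
    (U₁ ∩ U₂ ∩ ok).Nonempty

/-- An intact set: a set of correct nodes that is a quorum, and whose members are pairwise
intertwined in the system projected to it. -/
def IsIntact (S : FBQS V) (ok I : Set V) : Prop :=
  I ⊆ ok ∧ S.IsQuorum I ∧
    ∀ v₁ v₂ : I, (S.project I).Intertwined (((↑) : I → V) ⁻¹' ok) v₁ v₂

end FBQS

/-! ### Ballots -/

/-- Ballots: pairs of a positive round and a value, ordered lexicographically, together with the
null ballot `⊥`, which is the least one. -/
abbrev Ballot (X : Type v) := WithBot (ℕ+ ×ₗ X)

namespace Ballot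

variable {X : Type v}

/-- The ballot `⟨n, x⟩`. -/
def mk (n : ℕ+) (x : X) : Ballot X := ((toLex (n, x) : ℕ+ ×ₗ X) : WithBot (ℕ+ ×ₗ X))

/-- The round of a ballot, which is `0` for the null ballot. -/
def n : Ballot X → ℕ := WithBot.recBotCoe 0 (fun p => ((ofLex p).1 : ℕ))

/-- The value of a ballot, which is `none` for the null ballot. -/
def x : Ballot X → Option X := WithBot.recBotCoe none (fun p => some (ofLex p).2)

/-- `b'` is below and incompatible than `b`. -/
def Lic [LinearOrder X] (b' b : Ballot X) : Prop := b' < b ∧ b'.x ≠ b.x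

end Ballot

/-! ### Executions, traces and histories -/

/-- The events of a history. -/
inductive HEvent (V : Type u) (X : Type v)
  | propose (w : V) (x : X)
  | decide (w : V) (x : X)

/-- A global configuration: the local state of every node and, for every sender and recipient, the
messages in transit. -/
structure Config (V : Type u) (St : Type*) (M : Type*) where
  state : V → St
  chan : V → V → Multiset M

/-- One atomic step of a message-passing system in which the nodes in `ok` are correct. A correct
node performs a local action of its protocol, broadcasting the messages `out` to every node
(including itself), or receives a message in transit; a faulty node sends an arbitrary message to
an arbitrary node. Links are authenticated and neither create, nor drop, nor duplicate, nor order
messages. The list contains the events of correct nodes in that step, in their order. -/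
inductive NetStep {V : Type u} [Fintype V] [DecidableEq V] {St M E : Type*} (ok : Set V)
    (act : V → St → List E → List M → St → Prop) (rcv : V → St → V → M → St → Prop)
    (sendEv rcvEv : V → M → V → E) : Config V St M → List E → Config V St M → Prop
  | action (c : Config V St M) (w : V) (evs : List E) (out : List M) (s' : St) (hw : w ∈ ok)
      (h : act w (c.state w) evs out s') :
      NetStep ok act rcv sendEv rcvEv c
        (evs ++ out.flatMap (fun m => (Finset.univ : Finset V).toList.map (fun w' => sendEv w m w')))
        ⟨Function.update c.state w s',
          fun a b => if a = w then c.chan a b + (out : Multiset M) else c.chan a b⟩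
  | receive (c : Config V St M) (w w' : V) (m : M) (rest : Multiset M) (s' : St) (hw : w ∈ ok)
      (hm : c.chan w' w = m ::ₘ rest) (h : rcv w (c.state w) w' m s') :
      NetStep ok act rcv sendEv rcvEv c [rcvEv w m w']
        ⟨Function.update c.state w s',
          fun a b => if a = w' ∧ b = w then rest else c.chan a b⟩
  | faulty (c : Config V St M) (f w : V) (m : M) (hf : f ∉ ok) :
      NetStep ok act rcv sendEv rcvEv c []
        ⟨c.state, fun a b => if a = f ∧ b = w then m ::ₘ c.chan a b else c.chan a b⟩

/-- A finite or infinite sequence of events, given as the concatenation of the lists of events of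
the successive atomic steps. -/
abbrev Trace (E : Type*) := ℕ → List E

/-- `τ` is the trace of an execution, that is, of a finite or infinite run from the initial
configuration `c₀`. A finite run idles forever after its last step. -/
def IsExecutionTrace {C E : Type*} (c₀ : C) (step : C → List E → C → Prop) (τ : Trace E) : Prop :=
  ∃ c : ℕ → C, c 0 = c₀ ∧
    ∀ i, step (c i) (τ i) (c (i + 1)) ∨ (c (i + 1) = c i ∧ τ i = [])

open Classical in
/-- The projection of a trace to the nodes in `I`: the events of the other nodes are removed. -/
noncomputable def Trace.project {V : Type u} {E : Type*} (node : E → V) (I : Set V) (τ : Trace E) :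
    Trace E :=
  fun i => (τ i).filter (fun e => decide (node e ∈ I))

/-- The history of a trace: every event other than propose and decide is removed. A finite or
infinite sequence of propose and decide events is represented by the set of its finite prefixes,
which determines it. -/
def Trace.history {E H : Type*} (toH : E → Option H) (τ : Trace E) : Set (List H) :=
  {h | ∃ k, h <+: ((List.range k).flatMap τ).filterMap toH}

/-! ### The concrete protocol CSCP, over bunched voting -/

/-- The statements `PREP b` and `CMT b`. -/
inductive Stmt (X : Type v)
  | prep (b : Ballot X)
  | cmt (b : Ballot X)

/-- The messages `VOTE s` and `READY s`. -/
inductive CMsg (X : Type v)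
  | vote (s : Stmt X)
  | ready (s : Stmt X)

/-- The events of concrete traces. -/
inductive CEvent (V : Type u) (X : Type v)
  | propose (w : V) (x : X)
  | decide (w : V) (x : X)
  | prepare (w : V) (b : Ballot X)
  | commit (w : V) (b : Ballot X)
  | prepared (w : V) (b : Ballot X)
  | committed (w : V) (b : Ballot X)
  | startTimer (w : V) (r : ℕ)
  | timeout (w : V)
  | send (w : V) (m : CMsg X) (w' : V)
  | receive (w : V) (m : CMsg X) (w' : V)

/-- The node that an event belongs to. -/
def CEvent.node {V : Type u} {X : Type v} : CEvent V X → V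
  | propose w _ | decide w _ | prepare w _ | commit w _ | prepared w _ | committed w _
  | startTimer w _ | timeout w | send w _ _ | receive w _ _ => w

/-- The history event, if any, that an event of a concrete trace is. -/
def CEvent.toH {V : Type u} {X : Type v} : CEvent V X → Option (HEvent V X)
  | propose w x => some (.propose w x)
  | decide w x => some (.decide w x)
  | _ => none

/-- The local state of a correct node that runs CSCP. The field `recv w'` holds the messages
received from `w'`. -/
structure CState (V : Type u) (X : Type v) where
  started : Bool
  stopped : Bool
  recv : V → Set (CMsg X)
  maxVotedPrep : Ballot X
  maxReadiedPrep : Ballot X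
  maxDeliveredPrep : Ballot X
  votedCmt : Finset (Ballot X)
  readiedCmt : Finset (Ballot X)
  deliveredCmt : Finset (Ballot X)
  candidate : Ballot X
  prepared : Ballot X
  round : ℕ
  timer : Bool

/-- The initial state. -/
def CState.initial (V : Type u) (X : Type v) : CState V X where
  started := false
  stopped := false
  recv _ := ∅
  maxVotedPrep := ⊥
  maxReadiedPrep := ⊥
  maxDeliveredPrep := ⊥
  votedCmt := ∅
  readiedCmt := ∅
  deliveredCmt := ∅
  candidate := ⊥
  prepared := ⊥
  round := 0
  timer := false

namespace CState

variable {V : Type u} {X : Type v}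

/-- The node has proposed and has not decided. -/
def Active (s : CState V X) : Prop := s.started = true ∧ s.stopped = false

/-- Every member of `U` sent a message `M (PREP b')` such that every ballot below and incompatible
than `b` is below and incompatible than `b'`. -/
def PrepFrom [LinearOrder X] (s : CState V X) (M : Stmt X → CMsg X) (U : Set V) (b : Ballot X) :
    Prop :=
  ∀ w' ∈ U, ∃ b₁ : Ballot X, M (.prep b₁) ∈ s.recv w' ∧ ∀ b' : Ballot X, b'.Lic b → b'.Lic b₁

/-- Every member of `U` sent the message `M (CMT b)`. -/
def CmtFrom (s : CState V X) (M : Stmt X → CMsg X) (U : Set V) (b : Ballot X) : Prop :=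
  ∀ w' ∈ U, M (.cmt b) ∈ s.recv w'

/-- The primitive `prepare(b)` of bunched voting: the new state and the messages to broadcast. -/
def doPrepare [LinearOrder X] (s : CState V X) (b : Ballot X) : CState V X × List (CMsg X) :=
  if s.maxVotedPrep < b then ({ s with maxVotedPrep := b }, [.vote (.prep b)]) else (s, [])

/-- The primitive `commit(b)` of bunched voting: the new state and the messages to broadcast. -/
def doCommit [LinearOrder X] (s : CState V X) (b : Ballot X) : CState V X × List (CMsg X) :=
  if b ∉ s.votedCmt ∧ s.maxVotedPrep = b then
    ({ s with votedCmt := insert b s.votedCmt }, [.vote (.cmt b)])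
  else (s, [])

end CState

/-- The value of the next candidate ballot at a timeout: the value of the candidate ballot if no
ballot has been prepared, and the value of the highest prepared ballot otherwise. -/
def NextValue {X : Type v} (candidate prepared : Ballot X) (y : X) : Prop :=
  (prepared = ⊥ ∧ candidate.x = some y) ∨ (prepared ≠ ⊥ ∧ prepared.x = some y)

/-- The local actions of node `w` in CSCP: state before, invocations and indications, messages
broadcast, state after. -/
inductive CAct {V : Type u} {X : Type v} [LinearOrder X] (S : FBQS V) (w : V) :
    CState V X → List (CEvent V X) → List (CMsg X) → CState V X → Prop
  /-- `propose(x)`; the first event of a node -/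
  | propose (s : CState V X) (x : X) (hs : s.started = false) :
      CAct S w s [.propose w x, .prepare w (.mk 1 x)]
        (({ s with started := true, candidate := .mk 1 x } : CState V X).doPrepare (.mk 1 x)).2
        (({ s with started := true, candidate := .mk 1 x } : CState V X).doPrepare (.mk 1 x)).1
  /-- ready a prepare statement after hearing from a quorum -/
  | readyPrepQuorum (s : CState V X) (b : Ballot X) (hs : s.Active)
      (hb : IsGreatest {b : Ballot X | s.maxReadiedPrep < b ∧
        ∃ U, S.IsQuorum U ∧ w ∈ U ∧ s.PrepFrom .vote U b} b) :
      CAct S w s [] [.ready (.prep b)] { s with maxReadiedPrep := b }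
  /-- ready a prepare statement after hearing from a blocking set -/
  | readyPrepBlocking (s : CState V X) (b : Ballot X) (hs : s.Active)
      (hb : IsGreatest {b : Ballot X | s.maxReadiedPrep < b ∧
        ∃ B, S.IsBlocking w B ∧ s.PrepFrom .ready B b} b) :
      CAct S w s [] [.ready (.prep b)] { s with maxReadiedPrep := b }
  /-- `prepared(b)`, when `b` exceeds `prepared` but does not reach the candidate, or when it does
  not exceed `prepared` -/
  | preparedOnly (s : CState V X) (b : Ballot X) (hs : s.Active)
      (hb : IsGreatest {b : Ballot X | s.maxDeliveredPrep < b ∧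
        ∃ U, S.IsQuorum U ∧ w ∈ U ∧ s.PrepFrom .ready U b} b)
      (h : ¬ (s.prepared < b ∧ s.candidate ≤ b)) :
      CAct S w s [.prepared w b] []
        { s with maxDeliveredPrep := b, prepared := max s.prepared b }
  /-- `prepared(b)`, when `b` exceeds `prepared` and reaches the candidate -/
  | preparedCommit (s : CState V X) (b : Ballot X) (hs : s.Active)
      (hb : IsGreatest {b : Ballot X | s.maxDeliveredPrep < b ∧
        ∃ U, S.IsQuorum U ∧ w ∈ U ∧ s.PrepFrom .ready U b} b)
      (h : s.prepared < b ∧ s.candidate ≤ b) :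
      CAct S w s [.prepared w b, .commit w b]
        (({ s with maxDeliveredPrep := b, prepared := b, candidate := b } :
          CState V X).doCommit b).2
        (({ s with maxDeliveredPrep := b, prepared := b, candidate := b } :
          CState V X).doCommit b).1
  /-- ready a commit statement after hearing from a quorum -/
  | readyCmtQuorum (s : CState V X) (b : Ballot X) (U : Set V) (hs : s.Active)
      (hU : S.IsQuorum U) (hw : w ∈ U) (h : s.CmtFrom .vote U b) (hb : b ∉ s.readiedCmt) :
      CAct S w s [] [.ready (.cmt b)] { s with readiedCmt := insert b s.readiedCmt }
  /-- ready a commit statement after hearing from a blocking set -/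
  | readyCmtBlocking (s : CState V X) (b : Ballot X) (B : Set V) (hs : s.Active)
      (hB : S.IsBlocking w B) (h : s.CmtFrom .ready B b) (hb : b ∉ s.readiedCmt) :
      CAct S w s [] [.ready (.cmt b)] { s with readiedCmt := insert b s.readiedCmt }
  /-- `committed(b)`, upon which the node decides `b.x` and stops execution -/
  | committed (s : CState V X) (b : Ballot X) (x : X) (U : Set V) (hs : s.Active)
      (hx : b.x = some x) (hU : S.IsQuorum U) (hw : w ∈ U) (h : s.CmtFrom .ready U b)
      (hb : b ∉ s.deliveredCmt) :
      CAct S w s [.committed w b, .decide w x] []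
        { s with deliveredCmt := insert b s.deliveredCmt, stopped := true }
  /-- update the round and start the timer -/
  | startTimer (s : CState V X) (U : Set V) (β : V → Ballot X) (r : ℕ) (hs : s.Active)
      (hU : S.IsQuorum U) (hw : w ∈ U)
      (h : ∀ w' ∈ U, s.round < (β w').n ∧
        ∃ M : Stmt X → CMsg X, (M = .vote ∨ M = .ready) ∧
          (M (.cmt (β w')) ∈ s.recv w' ∨ M (.prep (β w')) ∈ s.recv w'))
      (hr : IsLeast ((fun w' => (β w').n) '' U) r) :
      CAct S w s [.startTimer w r] [] { s with round := r, timer := true }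
  /-- the timer expires -/
  | timeout (s : CState V X) (y : X) (hs : s.Active) (ht : s.timer = true)
      (hy : NextValue s.candidate s.prepared y) :
      CAct S w s [.timeout w, .prepare w (.mk s.round.succPNat y)]
        (({ s with timer := false, candidate := .mk s.round.succPNat y } :
          CState V X).doPrepare (.mk s.round.succPNat y)).2
        (({ s with timer := false, candidate := .mk s.round.succPNat y } :
          CState V X).doPrepare (.mk s.round.succPNat y)).1

/-- Reception of a message by an active node. -/
def CRcv {V : Type u} {X : Type v} [DecidableEq V] (_w : V) (s : CState V X) (w' : V) (m : CMsg X)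
    (s' : CState V X) : Prop :=
  s.Active ∧ s' = { s with recv := Function.update s.recv w' (insert m (s.recv w')) }

/-- `τ` is a trace entailed by an execution of CSCP over `S` in which the nodes in `ok` are
correct. -/
def IsCSCPTrace {V : Type u} {X : Type v} [Fintype V] [DecidableEq V] [LinearOrder X]
    (S : FBQS V) (ok : Set V) (τ : Trace (CEvent V X)) : Prop :=
  IsExecutionTrace (⟨fun _ => .initial V X, fun _ _ => 0⟩ : Config V (CState V X) (CMsg X))
    (NetStep ok (CAct S) CRcv CEvent.send CEvent.receive) τ

/-! ### The abstract protocol ASCP, over one instance of federated voting per ballot -/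

/-- The messages `VOTE(b, a)` and `READY(b, a)` of the instance of federated voting for `b`. -/
inductive AMsg (X : Type v)
  | vote (b : Ballot X) (a : Bool)
  | ready (b : Ballot X) (a : Bool)

/-- A batch, that is, a possibly infinite collection of messages that is sent and received at once.
The messages in it are taken in ascending ballot order, so that it is given by a set. -/
abbrev Batch (X : Type v) := Set (AMsg X)

/-- The events of abstract traces. -/
inductive AEvent (V : Type u) (X : Type v)
  | propose (w : V) (x : X)
  | decide (w : V) (x : X)
  | startTimer (w : V) (r : ℕ)
  | timeout (w : V)
  | voteBatch (w : V) (D : Set (Ballot X)) (a : Bool)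
  | deliverBatch (w : V) (D : Set (Ballot X)) (a : Bool)
  | sendBatch (w : V) (ms : Batch X) (w' : V)
  | receiveBatch (w : V) (ms : Batch X) (w' : V)

/-- The node that an event belongs to. -/
def AEvent.node {V : Type u} {X : Type v} : AEvent V X → V
  | propose w _ | decide w _ | startTimer w _ | timeout w | voteBatch w _ _ | deliverBatch w _ _
  | sendBatch w _ _ | receiveBatch w _ _ => w

/-- The history event, if any, that an event of an abstract trace is. -/
def AEvent.toH {V : Type u} {X : Type v} : AEvent V X → Option (HEvent V X)
  | propose w x => some (.propose w x)
  | decide w x => some (.decide w x)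
  | _ => none

/-- The local state of a correct node that runs ASCP. The sets `voted`, `readied` and `delivered`
hold the ballots whose instance of federated voting has the Boolean field of that name set;
`aborted` holds the ballots for which `deliver(false)` has been triggered. -/
structure AState (V : Type u) (X : Type v) where
  started : Bool
  stopped : Bool
  recv : V → Set (AMsg X)
  voted : Set (Ballot X)
  readied : Set (Ballot X)
  delivered : Set (Ballot X)
  aborted : Set (Ballot X)
  candidate : Ballot X
  prepared : Ballot X
  round : ℕ
  timer : Bool

/-- The initial state. -/
def AState.initial (V : Type u) (X : Type v) : AState V X where
  started := false
  stopped := false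
  recv _ := ∅
  voted := ∅
  readied := ∅
  delivered := ∅
  aborted := ∅
  candidate := ⊥
  prepared := ⊥
  round := 0
  timer := false

namespace AState

variable {V : Type u} {X : Type v}

/-- The node has proposed and has not decided. -/
def Active (s : AState V X) : Prop := s.started = true ∧ s.stopped = false

/-- Invoke `vote(a)` in the instance of every ballot in `D`: only the instances that have not voted
yet vote. -/
def doVote (s : AState V X) (D : Set (Ballot X)) : AState V X := { s with voted := s.voted ∪ D }

/-- The batch of vote messages that results from these invocations. -/
def voteMsgs (s : AState V X) (D : Set (Ballot X)) (a : Bool) : Batch X :=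
  (fun b => AMsg.vote b a) '' (D \ s.voted)

/-- Every member of `U` sent the message `M (b, a)`. -/
def From (s : AState V X) (M : Ballot X → Bool → AMsg X) (U : Set V) (b : Ballot X) (a : Bool) :
    Prop :=
  ∀ w' ∈ U, M b a ∈ s.recv w'

end AState

open Classical in
/-- The batches to send, given all the messages to send: none if there are no messages. -/
noncomputable def batchOf {X : Type v} (ms : Batch X) : List (Batch X) :=
  if ms = ∅ then [] else [ms]

/-- The local actions of node `w` in ASCP: state before, invocations and indications, batches
broadcast, state after. Under the batched semantics a rule of federated voting fires at once for a
set `D` of instances. -/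
inductive AAct {V : Type u} {X : Type v} [LinearOrder X] (S : FBQS V) (w : V) :
    AState V X → List (AEvent V X) → List (Batch X) → AState V X → Prop
  /-- `propose(x)`; the first event of a node -/
  | propose (s : AState V X) (x : X) (hs : s.started = false) :
      AAct S w s
        [.propose w x, .voteBatch w {b' : Ballot X | b'.Lic (.mk 1 x)} false]
        (batchOf (s.voteMsgs {b' : Ballot X | b'.Lic (.mk 1 x)} false))
        (({ s with started := true, candidate := .mk 1 x } : AState V X).doVote
          {b' : Ballot X | b'.Lic (.mk 1 x)})
  /-- federated voting: ready `a` after hearing votes from a quorum or readies from a blocking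
  set -/
  | ready (s : AState V X) (D : Set (Ballot X)) (a : Bool) (hs : s.Active) (hD : D.Nonempty)
      (h : ∀ b ∈ D, b ∉ s.readied ∧
        ((∃ U, S.IsQuorum U ∧ w ∈ U ∧ s.From .vote U b a) ∨
          (∃ B, S.IsBlocking w B ∧ s.From .ready B b a))) :
      AAct S w s [] [(fun b => AMsg.ready b a) '' D] { s with readied := s.readied ∪ D }
  /-- federated voting: deliver `false` after hearing readies from a quorum -/
  | deliverFalse (s : AState V X) (D : Set (Ballot X)) (hs : s.Active) (hD : D.Nonempty)
      (h : ∀ b ∈ D, b ∉ s.delivered ∧ ∃ U, S.IsQuorum U ∧ w ∈ U ∧ s.From .ready U b false) :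
      AAct S w s [.deliverBatch w D false] []
        { s with delivered := s.delivered ∪ D, aborted := s.aborted ∪ D }
  /-- federated voting: deliver `true` for ballot `b` after hearing readies from a quorum, upon
  which the node decides `b.x` and stops execution -/
  | deliverTrue (s : AState V X) (b : Ballot X) (x : X) (U : Set V) (hs : s.Active)
      (hx : b.x = some x) (hb : b ∉ s.delivered) (hU : S.IsQuorum U) (hw : w ∈ U)
      (h : s.From .ready U b true) :
      AAct S w s [.deliverBatch w {b} true, .decide w x] []
        { s with delivered := s.delivered ∪ {b}, stopped := true }
  /-- prepare a ballot `b` that does not reach the candidate -/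
  | prepareOnly (s : AState V X) (b : Ballot X) (hs : s.Active)
      (h : ∀ b' : Ballot X, b'.Lic b → b' ∈ s.aborted) (hb : s.prepared < b)
      (hc : ¬ s.candidate ≤ b) :
      AAct S w s [] [] { s with prepared := b }
  /-- prepare a ballot `b` that reaches the candidate, and vote to commit it -/
  | prepareVote (s : AState V X) (b : Ballot X) (hs : s.Active)
      (h : ∀ b' : Ballot X, b'.Lic b → b' ∈ s.aborted) (hb : s.prepared < b)
      (hc : s.candidate ≤ b) :
      AAct S w s [.voteBatch w {b} true] (batchOf (s.voteMsgs {b} true))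
        (({ s with prepared := b, candidate := b } : AState V X).doVote {b})
  /-- update the round and start the timer -/
  | startTimer (s : AState V X) (U : Set V) (β : V → Ballot X) (r : ℕ) (hs : s.Active)
      (hU : S.IsQuorum U) (hw : w ∈ U)
      (h : ∀ w' ∈ U, s.round < (β w').n ∧
        ∃ M : Ballot X → Bool → AMsg X, (M = .vote ∨ M = .ready) ∧
          (M (β w') true ∈ s.recv w' ∨
            ∃ z < β w', ∀ b' ∈ Set.Ico z (β w'), M b' false ∈ s.recv w'))
      (hr : IsLeast ((fun w' => (β w').n) '' U) r) :
      AAct S w s [.startTimer w r] [] { s with round := r, timer := true }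
  /-- the timer expires -/
  | timeout (s : AState V X) (y : X) (hs : s.Active) (ht : s.timer = true)
      (hy : NextValue s.candidate s.prepared y) :
      AAct S w s
        [.timeout w, .voteBatch w {b' : Ballot X | b'.Lic (.mk s.round.succPNat y)} false]
        (batchOf (s.voteMsgs {b' : Ballot X | b'.Lic (.mk s.round.succPNat y)} false))
        (({ s with timer := false, candidate := .mk s.round.succPNat y } : AState V X).doVote
          {b' : Ballot X | b'.Lic (.mk s.round.succPNat y)})

/-- Reception of a batch by an active node, which takes in all its messages at once. -/
def ARcv {V : Type u} {X : Type v} [DecidableEq V] (_w : V) (s : AState V X) (w' : V)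
    (ms : Batch X) (s' : AState V X) : Prop :=
  s.Active ∧ s' = { s with recv := Function.update s.recv w' (s.recv w' ∪ ms) }

/-- `ρ` is a trace entailed by an execution of ASCP over `S` in which the nodes in `ok` are
correct. -/
def IsASCPTrace {V : Type u} {X : Type v} [Fintype V] [DecidableEq V] [LinearOrder X]
    (S : FBQS V) (ok : Set V) (ρ : Trace (AEvent V X)) : Prop :=
  IsExecutionTrace (⟨fun _ => .initial V X, fun _ _ => 0⟩ : Config V (AState V X) (Batch X))
    (NetStep ok (AAct S) ARcv AEvent.sendBatch AEvent.receiveBatch) ρ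

end SCP

namespace SCP

universe u v

variable {V : Type u} {X : Type v}

/-! ### Ballots -/

namespace Ballot

/-! A history shows only proposals and decisions, so the abstract run may use other ballots, timers
and messages than the concrete one. Two facts make a very small run suffice. A node proposes and
decides at most once, so the concrete history is complete after finitely many steps
(`exists_history_stable`). And all members of `I` decide the same value `x` (`agreement`), which can
be read off the whole execution and fixed in advance.

The abstract run then lives in rounds 1 and 2: a correct node starts at a candidate `⟨1, y⟩` and
moves at most once, by a timeout, to `⟨2, x⟩`. A concrete ballot `⟨n, x⟩` collapses to `⟨min n 2,
x⟩`; a ballot with another value counts only through the rejections that it implies below `⟨1, x⟩`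
or `⟨2, x⟩` (`img`, `Covers`). Each relevant instance has a fixed wanted outcome: `true` for value
`x`, `false` below and incompatible with `⟨2, x⟩`. A flag set earlier thus never obstructs the
matching (`LocA`).

The hearing conditions of the rules are monotone in the received messages, so superfluous messages
do no harm. Faulty nodes send everything at the start, a correct node takes in all that is in
transit before it acts, and it is enough that the images of all concrete messages are available
(`Sim`). `Loc.matches_act` answers each concrete action by finitely many abstract ones with the same
visible events on `I`.

Agreement is the usual quorum argument: a READY from `I` to commit `b` rests on a quorum of commit
votes in the projected system, a READY to prepare something incompatible above `b` rests on a quorum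
that never casts this vote, and two such quorums meet (`Safe`). -/

theorem x_mk (n : ℕ+) (y : X) : (mk n y).x = some y := rfl

theorem n_mk (n : ℕ+) (y : X) : (mk n y).n = n := rfl

theorem x_bot : (⊥ : Ballot X).x = none := rfl

theorem mk_ne_bot (n : ℕ+) (y : X) : mk n y ≠ ⊥ := WithBot.coe_ne_bot

theorem eq_mk_of_ne_bot {b : Ballot X} (hb : b ≠ ⊥) : ∃ n y, b = mk n y := by
  obtain ⟨p, rfl⟩ := WithBot.ne_bot_iff_exists.1 hb
  exact ⟨(ofLex p).1, (ofLex p).2, rfl⟩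

theorem eq_mk_of_x_eq {b : Ballot X} {y : X} (hb : b.x = some y) : ∃ n, b = mk n y := by
  have h : b ≠ ⊥ := by
    rintro rfl
    simp [x_bot] at hb
  obtain ⟨n, z, rfl⟩ := eq_mk_of_ne_bot h
  rw [x_mk, Option.some_inj] at hb
  exact ⟨n, by rw [hb]⟩

theorem mk_inj {n m : ℕ+} {y z : X} : mk n y = mk m z ↔ n = m ∧ y = z := by
  unfold mk
  rw [WithBot.coe_inj]
  exact Prod.mk_inj

variable [LinearOrder X]

theorem mk_lt_mk {n m : ℕ+} {y z : X} : mk n y < mk m z ↔ n < m ∨ n = m ∧ y < z := by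
  unfold mk
  rw [WithBot.coe_lt_coe, Prod.Lex.toLex_lt_toLex]

theorem bot_lt_mk (n : ℕ+) (y : X) : ⊥ < mk n y := WithBot.bot_lt_coe _

theorem mk_lic_mk {n m : ℕ+} {y z : X} :
    (mk n y).Lic (mk m z) ↔ (n < m ∨ n = m ∧ y < z) ∧ y ≠ z := by
  rw [Lic, mk_lt_mk, x_mk, x_mk, ne_eq, Option.some_inj]

theorem bot_lic_mk (n : ℕ+) (y : X) : (⊥ : Ballot X).Lic (mk n y) :=
  ⟨bot_lt_mk n y, by simp [x_bot, x_mk]⟩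

theorem not_lic_of_x_eq {b c : Ballot X} (h : b.x = c.x) : ¬ b.Lic c := fun hl => hl.2 h

/-! ### Comparing the rejections that two ballots imply -/

/-- `b` covers `t` when every ballot below and incompatible than `t` is below and incompatible
than `b`. -/
def Covers (b t : Ballot X) : Prop := ∀ b' : Ballot X, b'.Lic t → b'.Lic b

theorem Covers.trans {a b c : Ballot X} (hab : a.Covers b) (hbc : b.Covers c) : a.Covers c :=
  fun b' h => hab b' (hbc b' h)

theorem covers_mk_mono {n m : ℕ+} (h : n ≤ m) (y : X) : (mk m y).Covers (mk n y) := by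
  intro b' hb'
  refine ⟨lt_of_lt_of_le hb'.1 ?_, hb'.2⟩
  rcases h.lt_or_eq with h | h
  · exact (mk_lt_mk.2 (Or.inl h)).le
  · rw [h]

/-- Below `⟨1, x⟩` there are only the null ballot and round-1 ballots with values less than `x`.
Hence a ballot with any value `y ≥ x`, in any round, serves to reject what stands in the way of `⟨1,
x⟩`. -/
theorem covers_one_of_le {n : ℕ+} {x y : X} (h : x ≤ y) : (mk n y).Covers (mk 1 x) := by
  intro b' hb'
  by_cases hb : b' = ⊥
  · rw [hb]
    exact bot_lic_mk n y
  · obtain ⟨k, z, rfl⟩ := eq_mk_of_ne_bot hb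
    rw [mk_lic_mk] at hb' ⊢
    obtain ⟨h1 | ⟨rfl, h1⟩, -⟩ := hb'
    · exact absurd h1 (not_lt_one)
    · have hz : z < y := lt_of_lt_of_le h1 h
      refine ⟨?_, hz.ne⟩
      rcases (one_le : 1 ≤ n).lt_or_eq with h | h
      · exact Or.inl h
      · exact Or.inr ⟨h, hz⟩

/-- The test ballot is `⟨1, y⟩`: it is compatible with `⟨n, y⟩`, but would lie below and be
incompatible with `⟨k, x⟩` if `y < x`. -/
theorem Covers.le_value {n k : ℕ+} {x y : X} (h : (mk n y).Covers (mk k x)) : x ≤ y := by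
  by_contra hlt
  have hlt : y < x := not_le.1 hlt
  have h1 : (mk 1 y).Lic (mk k x) := by
    rw [mk_lic_mk]
    refine ⟨?_, hlt.ne⟩
    rcases (one_le : 1 ≤ k).lt_or_eq with h | h
    · exact Or.inl h
    · exact Or.inr ⟨h, hlt⟩
  exact not_lic_of_x_eq (by rw [x_mk, x_mk]) (h _ h1)

/-- The same test ballot `⟨1, y⟩` works for every `y ≠ x`, because all of round 1 lies below `⟨k,
x⟩`. So beyond round 1 only ballots with value `x` can cover. -/
theorem Covers.value_eq {n k : ℕ+} {x y : X} (hk : 1 < k) (h : (mk n y).Covers (mk k x)) :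
    y = x := by
  by_contra hne
  have h1 : (mk 1 y).Lic (mk k x) := by
    rw [mk_lic_mk]
    exact ⟨Or.inl hk, hne⟩
  exact not_lic_of_x_eq (by rw [x_mk, x_mk]) (h _ h1)

end Ballot

/-! ### Quorums and blocking sets relative to an intact set -/

namespace FBQS

variable {S : FBQS V} {ok I : Set V}

theorem IsQuorum.project {U : Set V} (hU : S.IsQuorum U) {w : V} (hw : w ∈ U) (hI : w ∈ I) :
    (S.project I).IsQuorum (((↑) : I → V) ⁻¹' U) := by
  refine ⟨⟨⟨w, hI⟩, hw⟩, fun a ha => ?_⟩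
  obtain ⟨q, hq, hqU⟩ := hU.2 a ha
  exact ⟨_, ⟨q, hq, rfl⟩, Set.preimage_mono hqU⟩

theorem IsIntact.exists_mem_inter (hI : S.IsIntact ok I) {Q₁ Q₂ : Set I}
    (h₁ : (S.project I).IsQuorum Q₁) (h₂ : (S.project I).IsQuorum Q₂) : ∃ w, w ∈ Q₁ ∧ w ∈ Q₂ := by
  obtain ⟨a, ha⟩ := h₁.1
  obtain ⟨b, hb⟩ := h₂.1
  obtain ⟨w, hw, -⟩ := (hI.2.2 a b).2.2 Q₁ Q₂ h₁ h₂ ha hb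
  exact ⟨w, hw.1, hw.2⟩

/-- `I` is a quorum, so it contains a slice of `w`, which a blocking set must meet. A READY
triggered by a blocking set is therefore never the first of its kind from `I`. -/
theorem IsIntact.exists_mem_blocking (hI : S.IsIntact ok I) {w : V} (hw : w ∈ I) {B : Set V}
    (hB : S.IsBlocking w B) : ∃ u ∈ I, u ∈ B := by
  obtain ⟨q, hq, hqI⟩ := hI.2.1.2 w hw
  obtain ⟨u, huq, huB⟩ := hB q hq
  exact ⟨u, hqI huq, huB⟩

end FBQS

/-! ### Steps of CSCP -/

section Concrete

/-- A correct or faulty node `u` has sent the message `m`, which is in transit or received. -/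
def CSent (c : Config V (CState V X) (CMsg X)) (u : V) (m : CMsg X) : Prop :=
  ∃ w, m ∈ (c.state w).recv u ∨ m ∈ c.chan u w

variable [LinearOrder X]

/-- The node `w` heard from one of its quorums that `b` can be aborted up to. -/
def CState.PrepQuorum (S : FBQS V) (w : V) (s : CState V X) (M : Stmt X → CMsg X) (b : Ballot X) :
    Prop :=
  ∃ U, S.IsQuorum U ∧ w ∈ U ∧ s.PrepFrom M U b

theorem CState.PrepQuorum.of_recv {S : FBQS V} {w : V} {s s' : CState V X} {M : Stmt X → CMsg X}
    {b : Ballot X} (h : s.PrepQuorum S w M b) (hr : ∀ u, s.recv u ⊆ s'.recv u) :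
    s'.PrepQuorum S w M b := by
  obtain ⟨U, hU, hw, h⟩ := h
  refine ⟨U, hU, hw, fun u hu => ?_⟩
  obtain ⟨b₁, h₁, h₂⟩ := h u hu
  exact ⟨b₁, hr u h₁, h₂⟩

/-- What a local action of CSCP does to the voting layer. -/
structure CActSpec (S : FBQS V) (w : V) (s : CState V X) (out : List (CMsg X)) (s' : CState V X) :
    Prop where
  recv : s'.recv = s.recv
  started : s'.started = true
  maxVotedPrep_le : s.maxVotedPrep ≤ s'.maxVotedPrep
  prepared_le : s.prepared ≤ s'.prepared
  votePrep : ∀ b, CMsg.vote (.prep b) ∈ out → s'.maxVotedPrep = b ∧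
    (s.started = false ∨ ∃ y, b.x = some y ∧ NextValue s.candidate s.prepared y)
  voteCmt : ∀ b, CMsg.vote (.cmt b) ∈ out → s.maxVotedPrep = b ∧ s'.maxVotedPrep = b ∧ ⊥ < b ∧
    s'.prepared = b ∧ s.PrepQuorum S w .ready b
  readyPrep : ∀ b, CMsg.ready (.prep b) ∈ out →
    s.PrepQuorum S w .vote b ∨ ∃ B, S.IsBlocking w B ∧ s.PrepFrom .ready B b
  readyCmt : ∀ b, CMsg.ready (.cmt b) ∈ out →
    (∃ U, S.IsQuorum U ∧ w ∈ U ∧ s.CmtFrom .vote U b) ∨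
      ∃ B, S.IsBlocking w B ∧ s.CmtFrom .ready B b
  prepared : s'.prepared ≠ s.prepared → s.PrepQuorum S w .ready s'.prepared

theorem CAct.spec {S : FBQS V} {w : V} {s s' : CState V X} {evs : List (CEvent V X)}
    {out : List (CMsg X)} (h : CAct S w s evs out s') : CActSpec S w s out s' := by
  cases h with
  | propose x hs =>
    unfold CState.doPrepare
    split_ifs with hlt
    · constructor <;> simp [hs]
      exact le_of_lt hlt
    · constructor <;> simp
  | readyPrepQuorum b hs hb =>
    have := hb.1.2
    constructor <;> simp [hs.1]
    exact Or.inl this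
  | readyPrepBlocking b hs hb =>
    have := hb.1.2
    constructor <;> simp [hs.1]
    exact Or.inr this
  | preparedOnly b hs hb h =>
    have := hb.1.2
    constructor <;> simp [hs.1]
    intro hlt
    rw [max_eq_right hlt.le]
    exact this
  | preparedCommit b hs hb h =>
    have hq := hb.1.2
    have h0 := bot_le.trans_lt hb.1.1
    unfold CState.doCommit
    split_ifs with hif
    · have hm : s.maxVotedPrep = b := hif.2
      constructor <;> simp [hs.1, hm, h0, h.1.le]
      · exact hq
      · intro
        exact hq
    · constructor <;> simp [hs.1, h.1.le]
      intro
      exact hq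
  | readyCmtQuorum b U hs hU hw h hb =>
    constructor <;> simp [hs.1]
    exact Or.inl ⟨U, hU, hw, h⟩
  | readyCmtBlocking b B hs hB h hb =>
    constructor <;> simp [hs.1]
    exact Or.inr ⟨B, hB, h⟩
  | committed b x U hs hx hU hw h hb => constructor <;> simp [hs.1]
  | startTimer U β r hs hU hw h hr => constructor <;> simp [hs.1]
  | timeout y hs ht hy =>
    unfold CState.doPrepare
    split_ifs with hlt
    · constructor <;> simp [hs.1]
      · exact le_of_lt hlt
      · exact ⟨y, Ballot.x_mk _ _, hy⟩
    · constructor <;> simp [hs.1]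

variable [Fintype V] [DecidableEq V]

/-- A step of CSCP is a local action of a correct node, or it leaves the states of the nodes
unchanged except for the messages received. -/
theorem cStep_cases {S : FBQS V} {ok : Set V} {c c' : Config V (CState V X) (CMsg X)}
    {l : List (CEvent V X)}
    (h : NetStep ok (CAct S) CRcv CEvent.send CEvent.receive c l c') :
    (∃ w ∈ ok, ∃ evs out s', CAct S w (c.state w) evs out s' ∧
      (∃ l', l = evs ++ l' ∧ ∀ e ∈ l', e.toH = none) ∧ c'.state = Function.update c.state w s' ∧
      ∀ u m, CSent c' u m ↔ CSent c u m ∨ (u = w ∧ m ∈ out)) ∨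
    ((∀ e ∈ l, e.toH = none) ∧ (∀ u ∈ ok, ∀ m, CSent c' u m ↔ CSent c u m) ∧
      ∃ r : V → V → Set (CMsg X), (∀ u, c'.state u = { c.state u with recv := r u }) ∧
        (∀ u u', (c.state u).recv u' ⊆ r u u') ∧
        ∀ u, ¬ (c.state u).Active → r u = (c.state u).recv) := by
  cases h with
  | action w evs out s' hw h =>
    refine Or.inl ⟨w, hw, evs, out, s', h, ⟨_, rfl, ?_⟩, rfl, ?_⟩
    · intro e he
      simp only [List.mem_flatMap, List.mem_map] at he
      obtain ⟨m, -, w', -, rfl⟩ := he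
      rfl
    · intro u m
      have hr : ∀ w', (Function.update c.state w s' w').recv = (c.state w').recv := by
        intro w'
        by_cases hw' : w' = w
        · subst hw'
          rw [Function.update_self, h.spec.recv]
        · rw [Function.update_of_ne hw']
      constructor
      · rintro ⟨w', h1 | h1⟩
        · exact Or.inl ⟨w', Or.inl (by simpa only [hr] using h1)⟩
        · simp only at h1
          split_ifs at h1 with hu
          · rcases Multiset.mem_add.1 h1 with h1 | h1
            · exact Or.inl ⟨w', Or.inr h1⟩
            · exact Or.inr ⟨hu, by simpa using h1⟩
          · exact Or.inl ⟨w', Or.inr h1⟩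
      · rintro (⟨w', h1 | h1⟩ | ⟨rfl, h1⟩)
        · exact ⟨w', Or.inl (by simpa only [hr] using h1)⟩
        · refine ⟨w', Or.inr ?_⟩
          simp only
          split_ifs
          · exact Multiset.mem_add.2 (Or.inl h1)
          · exact h1
        · exact ⟨u, Or.inr (by simp [h1])⟩
  | receive w w' m rest s' hw hm h =>
    obtain ⟨ha, rfl⟩ := h
    refine Or.inr ⟨by simp [CEvent.toH], ?_, ?_⟩
    · intro u _ m'
      constructor
      · rintro ⟨a, h1 | h1⟩
        · by_cases haw : a = w
          · subst haw
            simp only [Function.update_self] at h1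
            by_cases hu : u = w'
            · subst hu
              simp only [Function.update_self, Set.mem_insert_iff] at h1
              rcases h1 with rfl | h1
              · exact ⟨a, Or.inr (by rw [hm]; exact Multiset.mem_cons_self _ _)⟩
              · exact ⟨a, Or.inl h1⟩
            · rw [Function.update_of_ne hu] at h1
              exact ⟨a, Or.inl h1⟩
          · simp only [Function.update_of_ne haw] at h1
            exact ⟨a, Or.inl h1⟩
        · simp only at h1
          split_ifs at h1 with hu
          · obtain ⟨rfl, rfl⟩ := hu
            exact ⟨a, Or.inr (by rw [hm]; exact Multiset.mem_cons_of_mem h1)⟩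
          · exact ⟨a, Or.inr h1⟩
      · rintro ⟨a, h1 | h1⟩
        · refine ⟨a, Or.inl ?_⟩
          by_cases haw : a = w
          · subst haw
            simp only [Function.update_self]
            by_cases hu : u = w'
            · subst hu
              simp [h1]
            · rwa [Function.update_of_ne hu]
          · simpa only [Function.update_of_ne haw] using h1
        · by_cases hu : u = w' ∧ a = w
          · obtain ⟨rfl, rfl⟩ := hu
            rw [hm, Multiset.mem_cons] at h1
            refine ⟨a, ?_⟩
            rcases h1 with rfl | h1
            · left
              simp
            · right
              simpa using h1
          · exact ⟨a, Or.inr (by simpa only [if_neg hu] using h1)⟩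
    · refine ⟨fun u => if u = w then Function.update (c.state w).recv w'
        (insert m ((c.state w).recv w')) else (c.state u).recv, ?_, ?_, ?_⟩
      · intro u
        by_cases hu : u = w
        · subst hu
          simp
        · simp [hu]
      · intro u u'
        by_cases hu : u = w
        · subst hu
          simp only [if_true]
          by_cases hu' : u' = w'
          · subst hu'
            simp
          · rw [Function.update_of_ne hu']
        · simp [hu]
      · intro u hu
        have : u ≠ w := by
          rintro rfl
          exact hu ha
        simp [this]
  | faulty f w m hf =>
    refine Or.inr ⟨by simp, ?_, fun u => (c.state u).recv, fun _ => rfl, fun _ _ => subset_rfl,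
      fun _ _ => rfl⟩
    intro u hu m'
    have hne : u ≠ f := by
      rintro rfl
      exact hf hu
    simp [CSent, hne]

end Concrete

/-! ### Agreement of CSCP on an intact set -/

section Safety

/-- The initial configuration of CSCP. -/
def cInit (V : Type u) (X : Type v) : Config V (CState V X) (CMsg X) :=
  ⟨fun _ => .initial V X, fun _ _ => 0⟩

theorem not_cSent_cInit (u : V) (m : CMsg X) : ¬ CSent (cInit V X) u m := by
  rintro ⟨w, h | h⟩
  · exact h
  · exact Multiset.notMem_zero _ h

variable [LinearOrder X]

/-- Invariants of CSCP that entail agreement on the set `I`. -/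
structure Safe (S : FBQS V) (I : Set V) (c : Config V (CState V X) (CMsg X)) : Prop where
  prepared : ∀ u ∈ I, (c.state u).prepared ≠ ⊥ →
    (c.state u).PrepQuorum S u .ready (c.state u).prepared
  -- Excludes a proposal, whose value is arbitrary, after a commit vote.
  not_started : ∀ u ∈ I, (c.state u).started = false → (c.state u).prepared = ⊥
  votePrep_le : ∀ u ∈ I, ∀ b, CSent c u (.vote (.prep b)) → b ≤ (c.state u).maxVotedPrep
  voteCmt : ∀ u ∈ I, ∀ b, CSent c u (.vote (.cmt b)) → ⊥ < b ∧ b ≤ (c.state u).prepared ∧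
    (c.state u).PrepQuorum S u .ready b
  -- After a commit vote for `b`, `prepared` is at least `b` and dictates the value of later
  -- candidates. Voting to prepare a different value thus means that `prepared` has already ruled
  -- out `b`, on evidence from `I`.
  conflict : ∀ u ∈ I, ∀ b b₂ : Ballot X, CSent c u (.vote (.cmt b)) →
    CSent c u (.vote (.prep b₂)) → b.Lic b₂ →
      ∃ w ∈ I, ∃ b₃, CSent c w (.ready (.prep b₃)) ∧ b.Lic b₃
  readyCmt : ∀ u ∈ I, ∀ b, CSent c u (.ready (.cmt b)) → ∃ Q : Set I, (S.project I).IsQuorum Q ∧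
    ∀ w ∈ Q, CSent c w (.vote (.cmt b))
  -- The strict bound makes the absence of the commit vote permanent, since that vote requires
  -- `maxVotedPrep` to equal `b`.
  readyPrep : ∀ u ∈ I, ∀ b b₃ : Ballot X, CSent c u (.ready (.prep b₃)) → b.Lic b₃ →
    ∃ Q : Set I, (S.project I).IsQuorum Q ∧
      ∀ w ∈ Q, b < (c.state w).maxVotedPrep ∧ ¬ CSent c w (.vote (.cmt b))

/-- The quorum contains `w` itself, so the evidence that `w` holds includes a message of its own. -/
theorem CState.PrepQuorum.exists_cSent {S : FBQS V} {w : V} {c : Config V (CState V X) (CMsg X)}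
    {M : Stmt X → CMsg X} {b b' : Ballot X} (h : (c.state w).PrepQuorum S w M b) (hb : b'.Lic b) :
    ∃ b₁, CSent c w (M (.prep b₁)) ∧ b'.Lic b₁ := by
  obtain ⟨U, -, hw, h⟩ := h
  obtain ⟨b₁, h₁, h₂⟩ := h w hw
  exact ⟨b₁, ⟨w, Or.inl h₁⟩, h₂ _ hb⟩

/-- The quorum that voted to commit `b` meets the quorum that never did. -/
theorem Safe.not_readyCmt_readyPrep {S : FBQS V} {ok I : Set V} (hI : S.IsIntact ok I)
    {c : Config V (CState V X) (CMsg X)} (hc : Safe S I c) {u w : V} (hu : u ∈ I) (hw : w ∈ I)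
    {b b₃ : Ballot X} (hb : b.Lic b₃) (h₁ : CSent c u (.ready (.cmt b)))
    (h₂ : CSent c w (.ready (.prep b₃))) : False := by
  obtain ⟨Q₁, hQ₁, h₁⟩ := hc.readyCmt u hu b h₁
  obtain ⟨Q₂, hQ₂, h₂⟩ := hc.readyPrep w hw b b₃ h₂ hb
  obtain ⟨a, ha₁, ha₂⟩ := hI.exists_mem_inter hQ₁ hQ₂
  exact (h₂ a ha₂).2 (h₁ a ha₁)

/-- Two members of an intact set that ready commit statements do so for compatible ballots. -/
theorem Safe.not_lic_of_readyCmt {S : FBQS V} {ok I : Set V} (hI : S.IsIntact ok I)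
    {c : Config V (CState V X) (CMsg X)} (hc : Safe S I c) {u w : V} (hu : u ∈ I) (hw : w ∈ I)
    {b b₂ : Ballot X} (h₁ : CSent c u (.ready (.cmt b))) (h₂ : CSent c w (.ready (.cmt b₂))) :
    ¬ b.Lic b₂ := by
  intro hb
  obtain ⟨Q, hQ, h₂⟩ := hc.readyCmt w hw b₂ h₂
  obtain ⟨a, ha⟩ := hQ.1
  -- A commit vote for `b₂` presupposes that `b₂` was prepared, hence an own READY of the voter
  -- against `b`.
  obtain ⟨b₁, h₃, h₄⟩ := (hc.voteCmt a a.2 b₂ (h₂ a ha)).2.2.exists_cSent hb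
  exact hc.not_readyCmt_readyPrep hI hu a.2 h₄ h₁ h₃

theorem Safe.quiet {S : FBQS V} {I : Set V} {c c' : Config V (CState V X) (CMsg X)}
    (hc : Safe S I c) (hsent : ∀ u ∈ I, ∀ m, CSent c' u m ↔ CSent c u m)
    {r : V → V → Set (CMsg X)} (hst : ∀ u, c'.state u = { c.state u with recv := r u })
    (hr : ∀ u u', (c.state u).recv u' ⊆ r u u') : Safe S I c' := by
  have hsQ : ∀ {u M b}, (c.state u).PrepQuorum S u M b → (c'.state u).PrepQuorum S u M b :=
    fun {u M b} h => h.of_recv (by rw [hst]; exact hr u)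
  refine ⟨?_, ?_, ?_, ?_, ?_, ?_, ?_⟩
  · intro u hu h
    have hp : (c'.state u).prepared = (c.state u).prepared := by rw [hst]
    rw [hp] at h ⊢
    exact hsQ (hc.prepared u hu h)
  · intro u hu h
    rw [hst] at h ⊢
    exact hc.not_started u hu h
  · intro u hu b h
    rw [hst]
    exact hc.votePrep_le u hu b ((hsent u hu _).1 h)
  · intro u hu b h
    obtain ⟨h1, h2, h3⟩ := hc.voteCmt u hu b ((hsent u hu _).1 h)
    refine ⟨h1, ?_, hsQ h3⟩
    rw [hst]
    exact h2
  · intro u hu b b₂ h h₂ hb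
    obtain ⟨w, hw, b₃, h3, h4⟩ :=
      hc.conflict u hu b b₂ ((hsent u hu _).1 h) ((hsent u hu _).1 h₂) hb
    exact ⟨w, hw, b₃, (hsent w hw _).2 h3, h4⟩
  · intro u hu b h
    obtain ⟨Q, hQ, h⟩ := hc.readyCmt u hu b ((hsent u hu _).1 h)
    exact ⟨Q, hQ, fun w hw => (hsent w w.2 _).2 (h w hw)⟩
  · intro u hu b b₃ h hb
    obtain ⟨Q, hQ, h⟩ := hc.readyPrep u hu b b₃ ((hsent u hu _).1 h) hb
    refine ⟨Q, hQ, fun w hw => ?_⟩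
    rw [hsent w w.2, hst]
    exact h w hw

theorem Safe.init (S : FBQS V) (I : Set V) : Safe S I (cInit V X) := by
  refine ⟨fun _ _ h => absurd rfl h, fun _ _ _ => rfl, ?_, ?_, ?_, ?_, ?_⟩ <;> intros <;>
    exact absurd (by assumption) (not_cSent_cInit _ _)

variable [Fintype V] [DecidableEq V]

/-- The crucial case is the first READY of a kind from `I`. It cannot come from a blocking set,
which contains an earlier sender in `I`, so it comes from a quorum of votes, whose projection to `I`
is the witness. -/
theorem Safe.action {S : FBQS V} {ok I : Set V} (hI : S.IsIntact ok I)
    {c c' : Config V (CState V X) (CMsg X)} (hc : Safe S I c) {w : V} {s' : CState V X}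
    {out : List (CMsg X)} (hs : CActSpec S w (c.state w) out s')
    (hst : c'.state = Function.update c.state w s')
    (hsent : ∀ u m, CSent c' u m ↔ CSent c u m ∨ (u = w ∧ m ∈ out)) : Safe S I c' := by
  have hmono : ∀ u m, CSent c u m → CSent c' u m := fun u m h => (hsent u m).2 (Or.inl h)
  have hself : c'.state w = s' := by rw [hst, Function.update_self]
  have hother : ∀ u, u ≠ w → c'.state u = c.state u := fun u hu => by
    rw [hst, Function.update_of_ne hu]
  have hrecv : ∀ u v, (c.state u).recv v ⊆ (c'.state u).recv v := by
    intro u v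
    by_cases hu : u = w
    · rw [hu, hself, hs.recv]
    · rw [hother u hu]
  have hvoted : ∀ u, (c.state u).maxVotedPrep ≤ (c'.state u).maxVotedPrep := by
    intro u
    by_cases hu : u = w
    · rw [hu, hself]
      exact hs.maxVotedPrep_le
    · rw [hother u hu]
  have hprep : ∀ u, (c.state u).prepared ≤ (c'.state u).prepared := by
    intro u
    by_cases hu : u = w
    · rw [hu, hself]
      exact hs.prepared_le
    · rw [hother u hu]
  have hsQ : ∀ {u M b}, (c.state u).PrepQuorum S u M b → (c'.state u).PrepQuorum S u M b :=
    fun {u M b} h => h.of_recv (hrecv u)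
  refine ⟨?_, ?_, ?_, ?_, ?_, ?_, ?_⟩
  · intro u hu h
    by_cases huw : u = w
    · subst huw
      by_cases heq : s'.prepared = (c.state u).prepared
      · rw [hself, heq] at h ⊢
        rw [← hself]
        exact hsQ (hc.prepared u hu h)
      · have := hsQ (hs.prepared heq)
        rwa [hself] at this ⊢
    · rw [hother u huw] at h ⊢
      exact hc.prepared u hu h
  · intro u hu h
    by_cases huw : u = w
    · subst huw
      rw [hself, hs.started] at h
      cases h
    · rw [hother u huw] at h ⊢
      exact hc.not_started u hu h
  · intro u hu b h
    rcases (hsent u _).1 h with h | ⟨rfl, h⟩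
    · exact (hc.votePrep_le u hu b h).trans (hvoted u)
    · rw [hself, (hs.votePrep b h).1]
  · intro u hu b h
    rcases (hsent u _).1 h with h | ⟨rfl, h⟩
    · obtain ⟨h1, h2, h3⟩ := hc.voteCmt u hu b h
      exact ⟨h1, h2.trans (hprep u), hsQ h3⟩
    · obtain ⟨h1, h2, h3, h4, h5⟩ := hs.voteCmt b h
      exact ⟨h3, by rw [hself, h4], hsQ h5⟩
  · intro u hu b b₂ h h₂ hb
    have hold : (∃ w ∈ I, ∃ b₃, CSent c w (.ready (.prep b₃)) ∧ b.Lic b₃) →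
        ∃ w ∈ I, ∃ b₃, CSent c' w (.ready (.prep b₃)) ∧ b.Lic b₃ := by
      rintro ⟨a, ha, b₃, h3, h4⟩
      exact ⟨a, ha, b₃, hmono _ _ h3, h4⟩
    rcases (hsent u _).1 h with h | ⟨rfl, h⟩
    · rcases (hsent u _).1 h₂ with h₂ | ⟨rfl, h₂⟩
      · exact hold (hc.conflict u hu b b₂ h h₂ hb)
      · apply hold
        obtain ⟨h0, hle, -⟩ := hc.voteCmt u hu b h
        have hne : (c.state u).prepared ≠ ⊥ := (h0.trans_le hle).ne'
        obtain ⟨-, hns | ⟨y, hy, ⟨hbot, -⟩ | ⟨-, hval⟩⟩⟩ := hs.votePrep b₂ h₂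
        · exact absurd (hc.not_started u hu hns) hne
        · exact absurd hbot hne
        · have hx : b.x ≠ (c.state u).prepared.x := by
            rw [hval, ← hy]
            exact hb.2
          have hlt : b.Lic (c.state u).prepared :=
            ⟨lt_of_le_of_ne hle fun he => hx (by rw [← he]), hx⟩
          obtain ⟨b₁, h3, h4⟩ := (hc.prepared u hu hne).exists_cSent hlt
          exact ⟨u, hu, b₁, h3, h4⟩
    -- The opposite order is impossible: the commit vote needs `maxVotedPrep` to be `b`, but the
    -- vote for `b₂` has raised it to at least `b₂`.
    · obtain ⟨-, h2, -⟩ := hs.voteCmt b h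
      have hle : b₂ ≤ s'.maxVotedPrep := by
        rcases (hsent u _).1 h₂ with h₂ | ⟨-, h₂⟩
        · exact (hc.votePrep_le u hu b₂ h₂).trans hs.maxVotedPrep_le
        · rw [(hs.votePrep b₂ h₂).1]
      exact absurd hb.1 (not_lt.2 (h2 ▸ hle))
  · intro u hu b h
    have hold : (∃ u ∈ I, CSent c u (.ready (.cmt b))) → ∃ Q : Set I, (S.project I).IsQuorum Q ∧
        ∀ w ∈ Q, CSent c' w (.vote (.cmt b)) := by
      rintro ⟨a, ha, h⟩
      obtain ⟨Q, hQ, h⟩ := hc.readyCmt a ha b h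
      exact ⟨Q, hQ, fun v hv => hmono _ _ (h v hv)⟩
    rcases (hsent u _).1 h with h | ⟨rfl, h⟩
    · exact hold ⟨u, hu, h⟩
    · rcases hs.readyCmt b h with ⟨U, hU, huU, hfrom⟩ | ⟨B, hB, hfrom⟩
      · exact ⟨_, hU.project huU hu, fun v hv => hmono _ _ ⟨u, Or.inl (hfrom v hv)⟩⟩
      · obtain ⟨a, ha, haB⟩ := hI.exists_mem_blocking hu hB
        exact hold ⟨a, ha, u, Or.inl (hfrom a haB)⟩
  · intro u hu b b₃ h hb
    have hold : (∃ u ∈ I, ∃ b₃ : Ballot X, CSent c u (.ready (.prep b₃)) ∧ b.Lic b₃) →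
        ∃ Q : Set I, (S.project I).IsQuorum Q ∧
          ∀ w ∈ Q, b < (c'.state w).maxVotedPrep ∧ ¬ CSent c' w (.vote (.cmt b)) := by
      rintro ⟨a, ha, b₃, h, hb⟩
      obtain ⟨Q, hQ, h⟩ := hc.readyPrep a ha b b₃ h hb
      refine ⟨Q, hQ, fun v hv => ⟨(h v hv).1.trans_le (hvoted v), fun hv' => ?_⟩⟩
      rcases (hsent v _).1 hv' with h1 | ⟨h1, h2⟩
      · exact (h v hv).2 h1
      · have h3 := (h v hv).1
        rw [h1, (hs.voteCmt b h2).1] at h3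
        exact lt_irrefl _ h3
    rcases (hsent u _).1 h with h | ⟨rfl, h⟩
    · exact hold ⟨u, hu, b₃, h, hb⟩
    · rcases hs.readyPrep b₃ h with ⟨U, hU, huU, hfrom⟩ | ⟨B, hB, hfrom⟩
      -- If no member of `I` has ruled out `b` before, no member of the quorum in `I` can have voted
      -- to commit `b`: by `conflict`, such a vote would yield an earlier READY against `b`.
      · by_cases hex : ∃ u ∈ I, ∃ b₃ : Ballot X, CSent c u (.ready (.prep b₃)) ∧ b.Lic b₃
        · exact hold hex
        · refine ⟨_, hU.project huU hu, fun v hv => ?_⟩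
          obtain ⟨b₁, h1, h2⟩ := hfrom v hv
          have hv1 : CSent c v (.vote (.prep b₁)) := ⟨u, Or.inl h1⟩
          have hlic := h2 b hb
          refine ⟨(hlic.1.trans_le (hc.votePrep_le v v.2 b₁ hv1)).trans_le (hvoted v), fun h3 => ?_⟩
          rcases (hsent v _).1 h3 with h3 | ⟨h3, h4⟩
          · exact hex (hc.conflict v v.2 b b₁ h3 hv1 hlic)
          · have h5 := hc.votePrep_le v v.2 b₁ hv1
            rw [h3, (hs.voteCmt b h4).1] at h5
            exact absurd hlic.1 (not_lt.2 h5)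
      · obtain ⟨a, ha, haB⟩ := hI.exists_mem_blocking hu hB
        obtain ⟨b₁, h1, h2⟩ := hfrom a haB
        exact hold ⟨a, ha, b₁, ⟨u, Or.inl h1⟩, h2 b hb⟩

theorem Safe.step {S : FBQS V} {ok I : Set V} (hI : S.IsIntact ok I)
    {c c' : Config V (CState V X) (CMsg X)} (hc : Safe S I c) {l : List (CEvent V X)}
    (h : NetStep ok (CAct S) CRcv CEvent.send CEvent.receive c l c') : Safe S I c' := by
  rcases cStep_cases h with ⟨w, -, evs, out, s', hact, -, hst, hsent⟩ | ⟨-, hsent, r, hst, hr, -⟩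
  · exact hc.action hI hact.spec hst hsent
  · exact hc.quiet (fun u hu => hsent u (hI.1 hu)) hst hr

theorem cSent_mono_step {S : FBQS V} {ok : Set V} {c c' : Config V (CState V X) (CMsg X)}
    {l : List (CEvent V X)} (h : NetStep ok (CAct S) CRcv CEvent.send CEvent.receive c l c')
    {u : V} (hu : u ∈ ok) {m : CMsg X} (hm : CSent c u m) : CSent c' u m := by
  rcases cStep_cases h with ⟨w, -, evs, out, s', hact, -, hst, hsent⟩ | ⟨-, hsent, -⟩
  · exact (hsent u m).2 (Or.inl hm)
  · exact (hsent u hu m).2 hm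

/-- A member of an intact set that decides a value has sent `READY (CMT b)` for a ballot with that
value. -/
theorem decide_cSent {S : FBQS V} {ok : Set V} {c c' : Config V (CState V X) (CMsg X)}
    {l : List (CEvent V X)} (h : NetStep ok (CAct S) CRcv CEvent.send CEvent.receive c l c')
    {w : V} {x : X} (hd : CEvent.decide w x ∈ l) :
    ∃ b : Ballot X, b.x = some x ∧ CSent c w (.ready (.cmt b)) := by
  rcases cStep_cases h with ⟨w', -, evs, out, s', hact, ⟨l', rfl, hl'⟩, -, -⟩ | ⟨hl, -⟩
  · rcases List.mem_append.1 hd with hd | hd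
    · cases hact with
      | committed b y U hs hx hU hw hfrom hb =>
        simp only [List.mem_cons, reduceCtorEq, CEvent.decide.injEq, List.not_mem_nil, or_false,
          false_or] at hd
        obtain ⟨rfl, rfl⟩ := hd
        -- The deciding node belongs to its own quorum, so it received a READY from itself.
        exact ⟨b, hx, w, Or.inl (hfrom w hw)⟩
      | _ => simp at hd
    · exact absurd (hl' _ hd) (by simp [CEvent.toH])
  · exact absurd (hl _ hd) (by simp [CEvent.toH])

/-- All the decisions of members of an intact set are equal. -/
theorem agreement {S : FBQS V} {ok I : Set V} (hI : S.IsIntact ok I)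
    {c : ℕ → Config V (CState V X) (CMsg X)} {τ : Trace (CEvent V X)} (h0 : c 0 = cInit V X)
    (hstep : ∀ i, NetStep ok (CAct S) CRcv CEvent.send CEvent.receive (c i) (τ i) (c (i + 1)) ∨
      (c (i + 1) = c i ∧ τ i = []))
    {i j : ℕ} {u w : V} (hu : u ∈ I) (hw : w ∈ I) {x y : X} (hi : CEvent.decide u x ∈ τ i)
    (hj : CEvent.decide w y ∈ τ j) : x = y := by
  have hsafe : ∀ i, Safe S I (c i) := by
    intro i
    induction i with
    | zero =>
      rw [h0]
      exact Safe.init S I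
    | succ i ih =>
      rcases hstep i with h | ⟨h, -⟩
      · exact ih.step hI h
      · rwa [h]
  have hmono : ∀ {i k u m}, u ∈ I → i ≤ k → CSent (c i) u m → CSent (c k) u m := by
    intro i k u m hu hik h
    induction hik with
    | refl => exact h
    | step _ ih =>
      rcases hstep _ with h' | ⟨h', -⟩
      · exact cSent_mono_step h' (hI.1 hu) ih
      · rwa [h']
  have hsent : ∀ {i u x}, CEvent.decide u x ∈ τ i →
      ∃ b : Ballot X, b.x = some x ∧ CSent (c i) u (.ready (.cmt b)) := by
    intro i u x h
    rcases hstep i with h' | ⟨-, h'⟩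
    · exact decide_cSent h' h
    · rw [h'] at h
      cases h
  obtain ⟨b, hbx, hb⟩ := hsent hi
  obtain ⟨b₂, hbx₂, hb₂⟩ := hsent hj
  have hb := hmono hu (le_max_left i j) hb
  have hb₂ := hmono hw (le_max_right i j) hb₂
  by_contra hne
  have hx : b.x ≠ b₂.x := by
    rw [hbx, hbx₂]
    exact fun h => hne (Option.some_inj.1 h)
  rcases lt_trichotomy b b₂ with hlt | rfl | hlt
  · exact (hsafe _).not_lic_of_readyCmt hI hu hw hb hb₂ ⟨hlt, hx⟩
  · exact hx rfl
  · exact (hsafe _).not_lic_of_readyCmt hI hw hu hb₂ hb ⟨hlt, hx.symm⟩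

end Safety

/-! ### Local runs of ASCP -/

section Abstract

theorem mem_batchOf {ms : Batch X} : {m | ∃ ms' ∈ batchOf ms, m ∈ ms'} = ms := by
  unfold batchOf
  split_ifs with h
  · simp [h]
  · simp

/-- The events in a list do not belong to histories. -/
def Silent (H : List (AEvent V X)) : Prop := H.filterMap AEvent.toH = []

theorem Silent.append {H₁ H₂ : List (AEvent V X)} (h₁ : Silent H₁) (h₂ : Silent H₂) :
    Silent (H₁ ++ H₂) := by
  unfold Silent at *
  rw [List.filterMap_append, h₁, h₂, List.append_nil]

variable [LinearOrder X]

/-- Finite sequences of local actions of node `w` in ASCP, with their events and the set of all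
messages broadcast. -/
inductive LSteps (S : FBQS V) (w : V) :
    AState V X → List (AEvent V X) → Set (AMsg X) → AState V X → Prop
  | nil (t : AState V X) : LSteps S w t [] ∅ t
  | cons {t t₁ t₂ : AState V X} {evs H : List (AEvent V X)} {out : List (Batch X)}
      {O : Set (AMsg X)} (h : AAct S w t evs out t₁) (h' : LSteps S w t₁ H O t₂) :
      LSteps S w t (evs ++ H) ({m | ∃ ms ∈ out, m ∈ ms} ∪ O) t₂

theorem LSteps.single {S : FBQS V} {w : V} {t t₁ : AState V X} {evs : List (AEvent V X)}
    {out : List (Batch X)} (h : AAct S w t evs out t₁) :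
    LSteps S w t evs {m | ∃ ms ∈ out, m ∈ ms} t₁ := by
  have := LSteps.cons h (LSteps.nil t₁)
  rwa [List.append_nil, Set.union_empty] at this

theorem LSteps.trans {S : FBQS V} {w : V} {t₁ t₂ t₃ : AState V X} {H₁ H₂ : List (AEvent V X)}
    {O₁ O₂ : Set (AMsg X)} (h₁ : LSteps S w t₁ H₁ O₁ t₂) (h₂ : LSteps S w t₂ H₂ O₂ t₃) :
    LSteps S w t₁ (H₁ ++ H₂) (O₁ ∪ O₂) t₃ := by
  induction h₁ with
  | nil t => simpa using h₂
  | cons h h' ih =>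
    rw [List.append_assoc, Set.union_assoc]
    exact LSteps.cons h (ih h₂)

theorem AAct.node {S : FBQS V} {w : V} {t t' : AState V X} {evs : List (AEvent V X)}
    {out : List (Batch X)} (h : AAct S w t evs out t') : ∀ e ∈ evs, e.node = w := by
  cases h <;> simp [AEvent.node]

theorem LSteps.node {S : FBQS V} {w : V} {t t' : AState V X} {H : List (AEvent V X)}
    {O : Set (AMsg X)} (h : LSteps S w t H O t') : ∀ e ∈ H, e.node = w := by
  induction h with
  | nil t => simp
  | cons h h' ih =>
    intro e he
    rcases List.mem_append.1 he with he | he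
    · exact h.node e he
    · exact ih e he

/-- The rule fires only for a non-empty set of instances not yet readied; if none is left, no action
is taken. -/
theorem LSteps.ready {S : FBQS V} {w : V} {t : AState V X} (ht : t.Active) (D : Set (Ballot X))
    (a : Bool) (h : ∀ b ∈ D, (∃ U, S.IsQuorum U ∧ w ∈ U ∧ t.From .vote U b a) ∨
      ∃ B, S.IsBlocking w B ∧ t.From .ready B b a) :
    LSteps S w t [] ((fun b => AMsg.ready b a) '' (D \ t.readied))
      { t with readied := t.readied ∪ (D \ t.readied) } := by
  rcases (D \ t.readied).eq_empty_or_nonempty with hD | hD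
  · rw [hD, Set.image_empty, Set.union_empty]
    exact LSteps.nil t
  · have := LSteps.single (AAct.ready (S := S) (w := w) t (D \ t.readied) a ht hD
      fun b hb => ⟨hb.2, h b hb.1⟩)
    convert this using 1
    simp only [List.mem_singleton, exists_eq_left, Set.ofPred_mem_eq]

/-! ### Invariants of a node in the two-round run -/

/-- The invariants of the state `t` of a correct node that has proposed, when `P` is the set of
messages it has broadcast and the abstract run aims for a decision on `x` at round 1 or 2. -/
structure LocA (x : X) (P : Set (AMsg X)) (t : AState V X) : Prop where
  -- The votes of the proposal; they are what abstract timers are started from.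
  base : ∃ y, ∀ b : Ballot X, b.Lic (.mk 1 y) → AMsg.vote b false ∈ P
  -- This and the next fields say that a flag already set agrees with the wanted outcome, so that
  -- the message or indication asked for exists already. There is no such field for `true` votes: a
  -- node that proposed a value above `x` has voted `false` on `⟨1, x⟩`.
  voted_false : ∀ b : Ballot X, b.Lic (.mk 2 x) → b ∈ t.voted → AMsg.vote b false ∈ P
  readied_false : ∀ b : Ballot X, b.Lic (.mk 2 x) → b ∈ t.readied → AMsg.ready b false ∈ P
  readied_true : ∀ k, .mk k x ∈ t.readied → AMsg.ready (.mk k x) true ∈ P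
  delivered_false : ∀ b : Ballot X, b.Lic (.mk 2 x) → b ∈ t.delivered → b ∈ t.aborted
  delivered_true : t.stopped = false → ∀ k, .mk k x ∉ t.delivered
  -- The first stage is the proposed candidate, before any timer; the second comes after the only
  -- timeout of the node. The guard `y = x` leaves out the nodes that voted `false` on `⟨1, x⟩` when
  -- proposing.
  stage : (∃ y, t.candidate = .mk 1 y ∧ t.round = 0 ∧
      (t.prepared = ⊥ ∨ t.prepared = .mk 1 x ∧ AMsg.vote (.mk 1 x) true ∈ P) ∧
      (y = x → .mk 1 x ∈ t.voted → AMsg.vote (.mk 1 x) true ∈ P) ∧ .mk 2 x ∉ t.voted) ∨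
    (t.candidate = .mk 2 x ∧ (∀ b : Ballot X, b.Lic (.mk 2 x) → b ∈ t.voted) ∧
      (.mk 2 x ∈ t.voted → AMsg.vote (.mk 2 x) true ∈ P) ∧
      (t.prepared < .mk 2 x ∨ t.prepared = .mk 2 x ∧ AMsg.vote (.mk 2 x) true ∈ P))

theorem lic_two_of_lic {k : ℕ+} (hk : k ≤ 2) {x : X} {b : Ballot X} (h : b.Lic (.mk k x)) :
    b.Lic (.mk 2 x) := Ballot.covers_mk_mono hk x b h

theorem not_mk_lic_mk {k n : ℕ+} {x : X} : ¬ (Ballot.mk k x).Lic (.mk n x) :=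
  Ballot.not_lic_of_x_eq rfl

/-- Deliver `false` for all the ballots below and incompatible than `⟨k, x⟩`. -/
theorem LocA.deliver {S : FBQS V} {w : V} {x : X} {P : Set (AMsg X)} {t : AState V X}
    (hA : LocA x P t) (ht : t.Active) {k : ℕ+} (hk : k ≤ 2)
    (hq : ∃ U, S.IsQuorum U ∧ w ∈ U ∧ ∀ b : Ballot X, b.Lic (.mk k x) → t.From .ready U b false) :
    ∃ H D, LSteps S w t H ∅ { t with delivered := t.delivered ∪ D, aborted := t.aborted ∪ D } ∧
      Silent H ∧ LocA x P { t with delivered := t.delivered ∪ D, aborted := t.aborted ∪ D } ∧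
      ∀ b : Ballot X, b.Lic (.mk k x) → b ∈ t.aborted ∪ D := by
  obtain ⟨U, hU, hw, hq⟩ := hq
  set D : Set (Ballot X) := {b | b.Lic (.mk k x)} \ t.delivered with hD
  have hsteps : ∃ H, LSteps S w t H ∅
      { t with delivered := t.delivered ∪ D, aborted := t.aborted ∪ D } ∧ Silent H := by
    rcases D.eq_empty_or_nonempty with hE | hE
    · refine ⟨[], ?_, rfl⟩
      simpa only [hE, Set.union_empty] using LSteps.nil t
    · refine ⟨[.deliverBatch w D false], ?_, rfl⟩
      have := LSteps.single (AAct.deliverFalse (S := S) (w := w) t D ht hE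
        fun b hb => ⟨hb.2, U, hU, hw, hq b hb.1⟩)
      simpa using this
  obtain ⟨H, hs, hsil⟩ := hsteps
  refine ⟨H, D, hs, hsil, ⟨hA.base, hA.voted_false, hA.readied_false, hA.readied_true, ?_, ?_,
    hA.stage⟩, ?_⟩
  · rintro b hb (h | h)
    · exact Or.inl (hA.delivered_false b hb h)
    · exact Or.inr h
  · rintro hst n (h | h)
    · exact hA.delivered_true hst n h
    · exact not_mk_lic_mk h.1
  · intro b hb
    by_cases hbd : b ∈ t.delivered
    · exact Or.inl (hA.delivered_false b (lic_two_of_lic hk hb) hbd)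
    · exact Or.inr ⟨hb, hbd⟩

theorem LocA.mono {x : X} {P P' : Set (AMsg X)} {t : AState V X} (hA : LocA x P t) (h : P ⊆ P') :
    LocA x P' t := by
  refine ⟨?_, fun b hb h' => h (hA.voted_false b hb h'), fun b hb h' => h (hA.readied_false b hb h'),
    fun k h' => h (hA.readied_true k h'), hA.delivered_false, hA.delivered_true, ?_⟩
  · obtain ⟨y, hy⟩ := hA.base
    exact ⟨y, fun b hb => h (hy b hb)⟩
  · rcases hA.stage with ⟨y, h1, h2, h3, h4, h5⟩ | ⟨h1, h2, h3, h4⟩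
    · exact Or.inl ⟨y, h1, h2, h3.imp_right fun h' => ⟨h'.1, h h'.2⟩, fun e m => h (h4 e m), h5⟩
    · exact Or.inr ⟨h1, h2, fun m => h (h3 m), h4.imp_right fun h' => ⟨h'.1, h h'.2⟩⟩

/-- Ready `false` for all the ballots below and incompatible than `⟨k, x⟩`. -/
theorem LocA.readyFalse {S : FBQS V} {w : V} {x : X} {P : Set (AMsg X)} {t : AState V X}
    (hA : LocA x P t) (ht : t.Active) {k : ℕ+} (hk : k ≤ 2)
    (h : ∀ b : Ballot X, b.Lic (.mk k x) → (∃ U, S.IsQuorum U ∧ w ∈ U ∧ t.From .vote U b false) ∨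
      ∃ B, S.IsBlocking w B ∧ t.From .ready B b false) :
    ∃ O D, LSteps S w t [] O { t with readied := t.readied ∪ D } ∧
      LocA x (P ∪ O) { t with readied := t.readied ∪ D } ∧
      ∀ b : Ballot X, b.Lic (.mk k x) → AMsg.ready b false ∈ P ∪ O := by
  have hall : ∀ b : Ballot X, b.Lic (.mk k x) → AMsg.ready b false ∈
      P ∪ (fun b => AMsg.ready b false) '' ({b : Ballot X | b.Lic (.mk k x)} \ t.readied) := by
    intro b hb
    by_cases hbr : b ∈ t.readied
    · exact Or.inl (hA.readied_false b (lic_two_of_lic hk hb) hbr)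
    · exact Or.inr ⟨b, ⟨hb, hbr⟩, rfl⟩
  refine ⟨_, _, LSteps.ready ht _ false h, ?_, hall⟩
  have hA' := hA.mono (P' := P ∪ (fun b => AMsg.ready b false) ''
    ({b : Ballot X | b.Lic (.mk k x)} \ t.readied)) Set.subset_union_left
  refine ⟨hA'.base, hA'.voted_false, ?_, ?_, hA'.delivered_false, hA'.delivered_true, hA'.stage⟩
  · rintro b hb (h | h)
    · exact hA'.readied_false b hb h
    · exact hall b h.1
  · rintro n (h | h)
    · exact hA'.readied_true n h
    · exact absurd h.1 not_mk_lic_mk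

/-- Ready `true` for the ballot `⟨k, x⟩`. -/
theorem LocA.readyTrue {S : FBQS V} {w : V} {x : X} {P : Set (AMsg X)} {t : AState V X}
    (hA : LocA x P t) (ht : t.Active) {k : ℕ+}
    (h : (∃ U, S.IsQuorum U ∧ w ∈ U ∧ t.From .vote U (.mk k x) true) ∨
      ∃ B, S.IsBlocking w B ∧ t.From .ready B (.mk k x) true) :
    ∃ O D, LSteps S w t [] O { t with readied := t.readied ∪ D } ∧
      LocA x (P ∪ O) { t with readied := t.readied ∪ D } ∧ AMsg.ready (.mk k x) true ∈ P ∪ O := by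
  have hall : AMsg.ready (.mk k x) true ∈
      P ∪ (fun b => AMsg.ready b true) '' ({.mk k x} \ t.readied) := by
    by_cases hbr : .mk k x ∈ t.readied
    · exact Or.inl (hA.readied_true k hbr)
    · exact Or.inr ⟨_, ⟨rfl, hbr⟩, rfl⟩
  refine ⟨_, _, LSteps.ready ht {.mk k x} true (by simpa using h), ?_, hall⟩
  have hA' := hA.mono (P' := P ∪ (fun b => AMsg.ready b true) ''
    ({.mk k x} \ t.readied)) Set.subset_union_left
  refine ⟨hA'.base, hA'.voted_false, ?_, ?_, hA'.delivered_false, hA'.delivered_true, hA'.stage⟩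
  · rintro b hb (h | h)
    · exact hA'.readied_false b hb h
    · rw [show b = .mk k x from h.1] at hb
      exact absurd hb not_mk_lic_mk
  · rintro n (h | h)
    · exact hA'.readied_true n h
    · rwa [show Ballot.mk n x = .mk k x from h.1]

/-- Vote `true` for the candidate ballot `⟨k, x⟩`, once it can be prepared. -/
theorem LocA.voteTrue {S : FBQS V} {w : V} {x : X} {P : Set (AMsg X)} {t : AState V X}
    (hA : LocA x P t) (ht : t.Active) {k : ℕ+} (hk : k ≤ 2) (hc : t.candidate = .mk k x)
    (hab : ∀ b : Ballot X, b.Lic (.mk k x) → b ∈ t.aborted) :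
    ∃ H O t', LSteps S w t H O t' ∧ Silent H ∧ LocA x (P ∪ O) t' ∧ t'.candidate = t.candidate ∧
      t'.started = t.started ∧ t'.stopped = t.stopped ∧ AMsg.vote (.mk k x) true ∈ P ∪ O := by
  have hvote : t.prepared < .mk k x → ∃ H O, LSteps S w t H O
      (({ t with prepared := .mk k x, candidate := .mk k x } : AState V X).doVote {.mk k x}) ∧
      Silent H ∧ (.mk k x ∉ t.voted → AMsg.vote (.mk k x) true ∈ O) := by
    intro hlt
    have h1 := LSteps.single (AAct.prepareVote (S := S) (w := w) t _ ht hab hlt hc.le)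
    rw [mem_batchOf] at h1
    exact ⟨_, _, h1, rfl, fun hn => ⟨_, ⟨rfl, hn⟩, rfl⟩⟩
  have hnil : AMsg.vote (.mk k x) true ∈ P → ∃ H O t', LSteps S w t H O t' ∧ Silent H ∧
      LocA x (P ∪ O) t' ∧ t'.candidate = t.candidate ∧
      t'.started = t.started ∧ t'.stopped = t.stopped ∧ AMsg.vote (.mk k x) true ∈ P ∪ O :=
    fun hP => ⟨[], ∅, t, LSteps.nil t, rfl, by rwa [Set.union_empty], rfl, rfl, rfl, Or.inl hP⟩
  have hvf : ∀ O, ∀ b : Ballot X, b.Lic (.mk 2 x) → b ∈ t.voted ∪ {.mk k x} →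
      AMsg.vote b false ∈ P ∪ O := by
    rintro O b hb (h | rfl)
    · exact Or.inl (hA.voted_false b hb h)
    · exact absurd hb not_mk_lic_mk
  -- The stage settles the two obstacles: if the ballot is already prepared or already voted, then
  -- the `true` vote has been sent.
  rcases hA.stage with ⟨y, h1, h2, h3, h4, h5⟩ | ⟨h1, h2, h3, h4⟩
  · obtain ⟨rfl, rfl⟩ := Ballot.mk_inj.1 (h1.symm.trans hc)
    rcases h3 with h3 | h3
    · obtain ⟨H, O, hs, hsil, hO⟩ := hvote (by rw [h3]; exact Ballot.bot_lt_mk _ _)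
      have hP : AMsg.vote (.mk 1 y) true ∈ P ∪ O := by
        by_cases hv : .mk 1 y ∈ t.voted
        · exact Or.inl (h4 rfl hv)
        · exact Or.inr (hO hv)
      have hA' := hA.mono (P' := P ∪ O) Set.subset_union_left
      refine ⟨H, O, _, hs, hsil, ⟨hA'.base, hvf O, hA'.readied_false, hA'.readied_true,
        hA'.delivered_false, hA'.delivered_true, Or.inl ⟨y, rfl, h2, Or.inr ⟨rfl, hP⟩,
          fun _ _ => hP, ?_⟩⟩, hc.symm, rfl, rfl, hP⟩
      rintro (h | h)
      · exact h5 h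
      · exact absurd (Ballot.mk_inj.1 h).1 (by decide)
    · exact hnil h3.2
  · obtain ⟨rfl, -⟩ := Ballot.mk_inj.1 (h1.symm.trans hc)
    rcases h4 with h4 | h4
    · obtain ⟨H, O, hs, hsil, hO⟩ := hvote h4
      have hP : AMsg.vote (.mk 2 x) true ∈ P ∪ O := by
        by_cases hv : .mk 2 x ∈ t.voted
        · exact Or.inl (h3 hv)
        · exact Or.inr (hO hv)
      have hA' := hA.mono (P' := P ∪ O) Set.subset_union_left
      exact ⟨H, O, _, hs, hsil, ⟨hA'.base, hvf O, hA'.readied_false, hA'.readied_true,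
        hA'.delivered_false, hA'.delivered_true, Or.inr ⟨rfl, fun b hb => Or.inl (h2 b hb),
          fun _ => hP, Or.inr ⟨rfl, hP⟩⟩⟩, hc.symm, rfl, rfl, hP⟩
    · exact hnil h4.2

/-- Prepare `⟨1, x⟩` unless `x` is the next value already. -/
theorem AState.exists_nextValue {S : FBQS V} {w : V} {x : X} {t : AState V X}
    {y : X} (ht : t.Active) (hc : t.candidate = .mk 1 y)
    (hp : t.prepared = ⊥ ∨ t.prepared = .mk 1 x)
    (h : y = x ∨ ∀ b : Ballot X, b.Lic (.mk 1 x) → b ∈ t.aborted) :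
    ∃ H O p c E, LSteps S w t H O { t with prepared := p, candidate := c, voted := t.voted ∪ E } ∧
      Silent H ∧ E ⊆ {.mk 1 x} ∧ NextValue c p x ∧ p < .mk 2 x := by
  have h12 : Ballot.mk 1 x < .mk 2 x := Ballot.mk_lt_mk.2 (Or.inl (by decide))
  have hnil : NextValue t.candidate t.prepared x →
      ∃ H O p c E, LSteps S w t H O { t with prepared := p, candidate := c, voted := t.voted ∪ E } ∧
      Silent H ∧ E ⊆ {.mk 1 x} ∧ NextValue c p x ∧ p < .mk 2 x := by
    intro hn
    refine ⟨[], ∅, t.prepared, t.candidate, ∅, ?_, rfl, Set.empty_subset _, hn, ?_⟩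
    · rw [Set.union_empty]
      exact LSteps.nil t
    · rcases hp with hp | hp <;> rw [hp]
      · exact Ballot.bot_lt_mk _ _
      · exact h12
  rcases hp with hp | hp
  · rcases h with rfl | h
    · exact hnil (Or.inl ⟨hp, by rw [hc, Ballot.x_mk]⟩)
    · have hlt : t.prepared < .mk 1 x := by
        rw [hp]
        exact Ballot.bot_lt_mk _ _
      by_cases hle : t.candidate ≤ .mk 1 x
      · refine ⟨_, _, .mk 1 x, .mk 1 x, {.mk 1 x},
          LSteps.single (AAct.prepareVote (S := S) (w := w) t _ ht h hlt hle), ?_, subset_rfl,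
          Or.inr ⟨Ballot.mk_ne_bot _ _, rfl⟩, h12⟩
        rfl
      · refine ⟨[], {m | ∃ ms ∈ ([] : List (Batch X)), m ∈ ms}, .mk 1 x, t.candidate, ∅, ?_, rfl,
          Set.empty_subset _, Or.inr ⟨Ballot.mk_ne_bot _ _, rfl⟩, h12⟩
        rw [Set.union_empty]
        exact LSteps.single (AAct.prepareOnly (S := S) (w := w) t _ ht h hlt hle)
  · exact hnil (Or.inr ⟨by rw [hp]; exact Ballot.mk_ne_bot _ _, by rw [hp, Ballot.x_mk]⟩)

/-- Move to the candidate ballot `⟨2, x⟩` through a timeout. -/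
theorem LocA.advance {S : FBQS V} {w : V} {x : X} {P : Set (AMsg X)} {t : AState V X}
    (hA : LocA x P t) (ht : t.Active)
    (hq : ∃ U, S.IsQuorum U ∧ w ∈ U ∧ ∀ u ∈ U, ∃ y, ∀ b : Ballot X, b.Lic (.mk 1 y) →
      AMsg.vote b false ∈ t.recv u)
    (h : t.candidate.x = some x ∨ ∀ b : Ballot X, b.Lic (.mk 1 x) → b ∈ t.aborted) :
    ∃ H O t', LSteps S w t H O t' ∧ Silent H ∧ LocA x (P ∪ O) t' ∧ t'.candidate = .mk 2 x ∧
      t'.started = t.started ∧ t'.stopped = t.stopped := by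
  rcases hA.stage with ⟨y, h1, h2, h3, h4, h5⟩ | ⟨h1, h2, h3, h4⟩
  · obtain ⟨H₁, O₁, p, c, E, hs₁, hsil₁, hE, hnext, hp⟩ :=
      AState.exists_nextValue (S := S) (w := w) (x := x) ht h1 (h3.imp_right And.left)
        (h.imp_left fun h' => by rwa [h1, Ballot.x_mk, Option.some_inj] at h')
    obtain ⟨U, hU, hw, hq⟩ := hq
    have : Nonempty X := ⟨x⟩
    choose! β hβ using hq
    set t₁ : AState V X := { t with prepared := p, candidate := c, voted := t.voted ∪ E } with ht₁
    have hs₂ : AAct S w t₁ [.startTimer w 1] [] { t₁ with round := 1, timer := true } := by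
      -- Everything below `⟨1, y⟩` is null or in round 1 with a smaller value, hence incompatible
      -- with it. The votes of a proposal therefore fill the whole interval from `⊥`, as the timer
      -- rule demands.
      refine AAct.startTimer t₁ U (fun u => .mk 1 (β u)) 1 ht hU hw (fun u hu => ⟨?_, ?_⟩) ?_
      · rw [Ballot.n_mk, show t₁.round = 0 from h2]
        exact PNat.pos 1
      · refine ⟨.vote, Or.inl rfl, Or.inr ⟨⊥, Ballot.bot_lt_mk _ _, fun b hb => hβ u hu b ?_⟩⟩
        refine ⟨hb.2, ?_⟩
        by_cases hb0 : b = ⊥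
        · rw [hb0, Ballot.x_bot, Ballot.x_mk]
          exact Option.some_ne_none _ |>.symm
        · obtain ⟨n, z, rfl⟩ := Ballot.eq_mk_of_ne_bot hb0
          rw [Ballot.x_mk, Ballot.x_mk]
          intro he
          rcases Ballot.mk_lt_mk.1 hb.2 with h' | ⟨-, h'⟩
          · exact not_lt_one h'
          · exact h'.ne (Option.some_inj.1 he)
      · refine ⟨⟨w, hw, rfl⟩, ?_⟩
        rintro _ ⟨u, -, rfl⟩
        exact le_rfl
    have hs₃ := AAct.timeout (S := S) (w := w) { t₁ with round := 1, timer := true } x ht rfl hnext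
    rw [show Nat.succPNat ({ t₁ with round := 1, timer := true } : AState V X).round = 2 from rfl]
      at hs₃
    have hs := hs₁.trans ((LSteps.single hs₂).trans (LSteps.single hs₃))
    rw [mem_batchOf] at hs
    refine ⟨_, _, _, hs, hsil₁.append rfl, ?_, rfl, rfl, rfl⟩
    set O := O₁ ∪ ({m | ∃ ms ∈ ([] : List (Batch X)), m ∈ ms} ∪
      AState.voteMsgs { t₁ with round := 1, timer := true } {b | b.Lic (.mk 2 x)} false) with hO
    have hA' := hA.mono (P' := P ∪ O) Set.subset_union_left
    refine ⟨hA'.base, ?_, hA'.readied_false, hA'.readied_true, hA'.delivered_false,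
      hA'.delivered_true, Or.inr ⟨rfl, fun b hb => Or.inr hb, ?_, Or.inl hp⟩⟩
    · intro b hb _
      by_cases hbv : b ∈ t.voted ∪ E
      · rcases hbv with hbv | hbv
        · exact hA'.voted_false b hb hbv
        · rw [show b = .mk 1 x from hE hbv] at hb
          exact absurd hb not_mk_lic_mk
      · exact Or.inr (Or.inr (Or.inr ⟨b, ⟨hb, hbv⟩, rfl⟩))
    · rintro ((h | h) | h)
      · exact absurd h h5
      · exact absurd (Ballot.mk_inj.1 (hE h)).1 (by decide)
      · exact absurd h not_mk_lic_mk
  · exact ⟨[], ∅, t, LSteps.nil t, rfl, by rwa [Set.union_empty], h1, rfl, rfl⟩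

end Abstract

/-! ### Local simulation of CSCP by ASCP -/

section LocalSimulation

variable [LinearOrder X]

/-- The abstract messages that stand for a concrete one in a run that aims for a decision on `x` at
round 1 or 2. -/
def img (x : X) : CMsg X → Set (AMsg X)
  -- Rejections beyond `⟨2, x⟩` are dropped, and so are all those of a ballot that covers neither
  -- `⟨1, x⟩` nor `⟨2, x⟩`. A commit statement for another value has no image, as no member of `I`
  -- decides that value.
  | .vote (.prep b) => {m | ∃ k : ℕ+, k ≤ 2 ∧ b.Covers (.mk k x) ∧
      ∃ b' : Ballot X, b'.Lic (.mk k x) ∧ m = .vote b' false}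
  | .ready (.prep b) => {m | ∃ k : ℕ+, k ≤ 2 ∧ b.Covers (.mk k x) ∧
      ∃ b' : Ballot X, b'.Lic (.mk k x) ∧ m = .ready b' false}
  | .vote (.cmt b) => {m | ∃ n : ℕ+, b = .mk n x ∧ m = .vote (.mk (min n 2) x) true}
  | .ready (.cmt b) => {m | ∃ n : ℕ+, b = .mk n x ∧ m = .ready (.mk (min n 2) x) true}

/-- The relation between the concrete state `s` and the abstract state `t` of a correct node `w`,
when `P` is the set of abstract messages it has broadcast. -/
structure Loc (S : FBQS V) (x : X) (w : V) (P : Set (AMsg X)) (s : CState V X) (t : AState V X) :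
    Prop where
  init : s.started = false → s = .initial V X ∧ t = .initial V X
  started : t.started = s.started
  -- Only one direction: a node outside `I` may decide another value, and then it just does nothing
  -- more in the abstract run.
  stopped : t.stopped = true → s.stopped = true
  abs : s.started = true → LocA x P t
  -- A commit vote is always for `maxVotedPrep`; this field and the next ensure that the abstract
  -- candidate is the right one when such a vote has value `x`.
  voted_one : s.maxVotedPrep = .mk 1 x → t.candidate = .mk 1 x
  voted_two : ∀ n, 1 < n → s.maxVotedPrep = .mk n x → t.candidate = .mk 2 x
  -- While nothing is prepared the candidate keeps the proposed value. Further votes to prepare it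
  -- then add no rejections for round 1, and the value `x`, if proposed, is also the abstract one.
  candidate : s.prepared = ⊥ → ∀ y, s.candidate.x = some y →
    (x ≤ y → ∀ b : Ballot X, b.Lic (.mk 1 x) → AMsg.vote b false ∈ P) ∧
      (y = x → t.candidate.x = some x)
  prepared : s.prepared ≠ ⊥ → s.PrepQuorum S w .ready s.prepared
  -- Any message at all shows that its sender has proposed, so one from each member of a quorum is
  -- enough to start the abstract timer.
  timer : s.timer = true → 1 ≤ s.round ∧
    ∃ U, S.IsQuorum U ∧ w ∈ U ∧ ∀ u ∈ U, ∃ m, m ∈ s.recv u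

/-- The abstract state `t` has received all the messages that stand for those that the concrete
state `s` has received. -/
def Heard (x : X) (s : CState V X) (t : AState V X) : Prop :=
  ∀ u, ∀ m ∈ s.recv u, (∃ y, ∀ b : Ballot X, b.Lic (.mk 1 y) → AMsg.vote b false ∈ t.recv u) ∧
    img x m ⊆ t.recv u

variable {S : FBQS V} {x : X} {w : V} {P : Set (AMsg X)} {s s' : CState V X} {t t' : AState V X}

theorem Heard.votePrep (h : Heard x s t) {U : Set V} {b b' : Ballot X} (hf : s.PrepFrom .vote U b)
    {k : ℕ+} (hk : k ≤ 2) (hb : b.Covers (.mk k x)) (hb' : b'.Lic (.mk k x)) :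
    t.From .vote U b' false := by
  intro u hu
  obtain ⟨b₁, h₁, h₂⟩ := hf u hu
  exact (h u _ h₁).2 ⟨k, hk, Ballot.Covers.trans h₂ hb, b', hb', rfl⟩

theorem Heard.readyPrep (h : Heard x s t) {U : Set V} {b b' : Ballot X}
    (hf : s.PrepFrom .ready U b) {k : ℕ+} (hk : k ≤ 2) (hb : b.Covers (.mk k x))
    (hb' : b'.Lic (.mk k x)) : t.From .ready U b' false := by
  intro u hu
  obtain ⟨b₁, h₁, h₂⟩ := hf u hu
  exact (h u _ h₁).2 ⟨k, hk, Ballot.Covers.trans h₂ hb, b', hb', rfl⟩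

theorem Heard.voteCmt (h : Heard x s t) {U : Set V} {n : ℕ+} (hf : s.CmtFrom .vote U (.mk n x)) :
    t.From .vote U (.mk (min n 2) x) true :=
  fun u hu => (h u _ (hf u hu)).2 ⟨n, rfl, rfl⟩

theorem Heard.readyCmt (h : Heard x s t) {U : Set V} {n : ℕ+}
    (hf : s.CmtFrom .ready U (.mk n x)) : t.From .ready U (.mk (min n 2) x) true :=
  fun u hu => (h u _ (hf u hu)).2 ⟨n, rfl, rfl⟩

theorem Loc.active (h : Loc S x w P s t) (hs : s.Active) : t.Active := by
  refine ⟨h.started.trans hs.1, ?_⟩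
  cases ht : t.stopped with
  | false => rfl
  | true => exact absurd ((h.stopped ht).symm.trans hs.2) (by decide)

/-- Local actions that leave alone the candidate, prepared and highest voted ballots. -/
theorem Loc.update (h : Loc S x w P s t) {P' : Set (AMsg X)} (hP : P ⊆ P')
    (hs' : s'.started = true) (hA : LocA x P' t') (ht₁ : t'.started = true)
    (ht₂ : t'.stopped = true → s'.stopped = true) (ht₃ : t'.candidate = t.candidate)
    (h₁ : s'.maxVotedPrep = s.maxVotedPrep) (h₂ : s'.candidate = s.candidate)
    (h₃ : s'.prepared = s.prepared) (h₄ : s'.recv = s.recv)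
    (h₅ : s'.timer = true → 1 ≤ s'.round ∧
      ∃ U, S.IsQuorum U ∧ w ∈ U ∧ ∀ u ∈ U, ∃ m, m ∈ s'.recv u) : Loc S x w P' s' t' where
  init hs := absurd (hs.symm.trans hs') (by decide)
  started := ht₁.trans hs'.symm
  stopped := ht₂
  abs _ := hA
  voted_one hv := by rw [ht₃]; exact h.voted_one (h₁ ▸ hv)
  voted_two n hn hv := by rw [ht₃]; exact h.voted_two n hn (h₁ ▸ hv)
  candidate hp y hy := by
    rw [h₃] at hp
    rw [h₂] at hy
    obtain ⟨h6, h7⟩ := h.candidate hp y hy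
    exact ⟨fun hxy b hb => hP (h6 hxy b hb), fun e => ht₃ ▸ h7 e⟩
  prepared hp := by
    rw [h₃] at hp ⊢
    exact (h.prepared hp).of_recv fun u => by rw [h₄]
  timer := h₅

/-- Local actions that raise the prepared ballot. -/
theorem Loc.update_prepared (h : Loc S x w P s t) {P' : Set (AMsg X)}
    (hs' : s'.started = true) (hA : LocA x P' t') (ht₁ : t'.started = true)
    (ht₂ : t'.stopped = true → s'.stopped = true) (ht₃ : t'.candidate = t.candidate)
    (h₁ : s'.maxVotedPrep = s.maxVotedPrep) (h₂ : s'.prepared ≠ ⊥)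
    (h₃ : s'.PrepQuorum S w .ready s'.prepared) (h₄ : s'.recv = s.recv)
    (h₅ : s'.timer = s.timer) (h₆ : s'.round = s.round) : Loc S x w P' s' t' where
  init hs := absurd (hs.symm.trans hs') (by decide)
  started := ht₁.trans hs'.symm
  stopped := ht₂
  abs _ := hA
  voted_one hv := by rw [ht₃]; exact h.voted_one (h₁ ▸ hv)
  voted_two n hn hv := by rw [ht₃]; exact h.voted_two n hn (h₁ ▸ hv)
  candidate hp := absurd hp h₂
  prepared _ := h₃
  timer ht := by
    rw [h₄, h₆]
    exact h.timer (h₅ ▸ ht)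

/-- The rejections for `⟨1, x⟩` are among those for `⟨2, x⟩`, so only the largest `k ≤ 2` that is
covered matters; if there is none, the image is empty. -/
theorem LocA.readyPrep (hA : LocA x P t) (ht : t.Active) {b : Ballot X}
    (h : ∀ k : ℕ+, k ≤ 2 → b.Covers (.mk k x) → ∀ b' : Ballot X, b'.Lic (.mk k x) →
      (∃ U, S.IsQuorum U ∧ w ∈ U ∧ t.From .vote U b' false) ∨
        ∃ B, S.IsBlocking w B ∧ t.From .ready B b' false) :
    ∃ O D, LSteps S w t [] O { t with readied := t.readied ∪ D } ∧
      LocA x (P ∪ O) { t with readied := t.readied ∪ D } ∧ img x (.ready (.prep b)) ⊆ P ∪ O := by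
  by_cases h2 : b.Covers (.mk 2 x)
  · obtain ⟨O, D, h3, h4, h5⟩ := hA.readyFalse ht le_rfl (h 2 le_rfl h2)
    refine ⟨O, D, h3, h4, ?_⟩
    rintro _ ⟨k, hk, -, b', hb', rfl⟩
    exact h5 b' (lic_two_of_lic hk hb')
  · have hk1 : ∀ k : ℕ+, k ≤ 2 → b.Covers (.mk k x) → k = 1 := by
      intro k hk hb
      rcases hk.lt_or_eq with hk | rfl
      · exact le_antisymm (PNat.lt_add_one_iff.1 hk) one_le
      · exact absurd hb h2
    by_cases h1 : b.Covers (.mk 1 x)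
    · obtain ⟨O, D, h3, h4, h5⟩ := hA.readyFalse ht (by decide) (h 1 (by decide) h1)
      refine ⟨O, D, h3, h4, ?_⟩
      rintro _ ⟨k, hk, hb, b', hb', rfl⟩
      obtain rfl := hk1 k hk hb
      exact h5 b' hb'
    · refine ⟨∅, ∅, ?_, ?_, ?_⟩
      · rw [Set.union_empty]
        exact LSteps.nil t
      · rwa [Set.union_empty, Set.union_empty]
      · rintro _ ⟨k, hk, hb, b', hb', rfl⟩
        obtain rfl := hk1 k hk hb
        exact absurd hb h1

theorem LocA.readyCmt (hA : LocA x P t) (ht : t.Active) {b : Ballot X}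
    (h : ∀ n, b = .mk n x → (∃ U, S.IsQuorum U ∧ w ∈ U ∧ t.From .vote U (.mk (min n 2) x) true) ∨
        ∃ B, S.IsBlocking w B ∧ t.From .ready B (.mk (min n 2) x) true) :
    ∃ O D, LSteps S w t [] O { t with readied := t.readied ∪ D } ∧
      LocA x (P ∪ O) { t with readied := t.readied ∪ D } ∧ img x (.ready (.cmt b)) ⊆ P ∪ O := by
  by_cases h1 : ∃ n, b = .mk n x
  · obtain ⟨n, rfl⟩ := h1
    obtain ⟨O, D, h3, h4, h5⟩ := hA.readyTrue ht (h n rfl)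
    refine ⟨O, D, h3, h4, ?_⟩
    rintro _ ⟨m, hm, rfl⟩
    obtain ⟨rfl, -⟩ := Ballot.mk_inj.1 hm
    exact h5
  · refine ⟨∅, ∅, ?_, ?_, ?_⟩
    · rw [Set.union_empty]
      exact LSteps.nil t
    · rwa [Set.union_empty, Set.union_empty]
    · rintro _ ⟨n, hn, rfl⟩
      exact absurd ⟨n, hn⟩ h1

/-! ### Matching the local actions one by one -/

/-- The node `w` can match, by a sequence of abstract local actions, a concrete local action that
leads to `s'` with the events `evs` and the messages `out`. -/
def Matches (S : FBQS V) (I : Set V) (x : X) (w : V) (P : Set (AMsg X)) (t : AState V X)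
    (evs : List (CEvent V X)) (out : List (CMsg X)) (s' : CState V X) : Prop :=
  ∃ H O t', LSteps S w t H O t' ∧ Loc S x w (P ∪ O) s' t' ∧ (∀ m ∈ out, img x m ⊆ P ∪ O) ∧
    (w ∈ I → H.filterMap AEvent.toH = evs.filterMap CEvent.toH)

variable {I : Set V}

theorem Loc.matches_propose (hL : Loc S x w P s t) (hs : s.started = false) (x₀ : X) :
    Matches S I x w P t [.propose w x₀, .prepare w (.mk 1 x₀)]
      (({ s with started := true, candidate := .mk 1 x₀ } : CState V X).doPrepare (.mk 1 x₀)).2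
      (({ s with started := true, candidate := .mk 1 x₀ } : CState V X).doPrepare (.mk 1 x₀)).1 := by
  classical
  obtain ⟨rfl, rfl⟩ := hL.init hs
  have hlt : (⊥ : Ballot X) < .mk 1 x₀ := Ballot.bot_lt_mk _ _
  have hdo : ({ CState.initial V X with started := true, candidate := .mk 1 x₀ } :
      CState V X).doPrepare (.mk 1 x₀) = ({ CState.initial V X with
        started := true, candidate := .mk 1 x₀, maxVotedPrep := .mk 1 x₀ },
        [.vote (.prep (.mk 1 x₀))]) := if_pos hlt
  rw [hdo]
  -- The proposal is kept on `I` and replaced by `x` elsewhere, where the history does not show it.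
  -- Either way the resulting votes contain the image of the concrete vote.
  obtain ⟨z, hz, hzI⟩ : ∃ z, (z = x₀ ∨ z = x) ∧ (w ∈ I → z = x₀) := by
    by_cases hw : w ∈ I
    · exact ⟨x₀, Or.inl rfl, fun _ => rfl⟩
    · exact ⟨x, Or.inr rfl, fun h => absurd h hw⟩
  have hzx : x₀ = x → z = x := by
    rintro rfl
    exact hz.elim id id
  have hstep := LSteps.single (AAct.propose (S := S) (w := w) (AState.initial V X) z rfl)
  rw [mem_batchOf] at hstep
  have hO : ∀ b : Ballot X, b.Lic (.mk 1 z) → AMsg.vote b false ∈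
      P ∪ (AState.initial V X).voteMsgs {b : Ballot X | b.Lic (.mk 1 z)} false :=
    fun b hb => Or.inr ⟨b, ⟨hb, fun h => h⟩, rfl⟩
  have hone : x ≤ x₀ → ∀ b : Ballot X, b.Lic (.mk 1 x) → b.Lic (.mk 1 z) := by
    intro hle b hb
    rcases hz with rfl | rfl
    · exact Ballot.covers_one_of_le hle b hb
    · exact hb
  refine ⟨_, _, _, hstep, ⟨?_, rfl, ?_, fun _ => ?_, ?_, ?_, ?_, ?_, ?_⟩, ?_, ?_⟩
  · intro h
    cases h
  · intro h
    cases h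
  · refine ⟨⟨z, hO⟩, ?_, fun _ _ h => absurd h (Set.notMem_empty _),
      fun _ h => absurd h (Set.notMem_empty _), fun _ _ h => absurd h (Set.notMem_empty _),
      fun _ _ h => absurd h (Set.notMem_empty _), Or.inl ⟨z, rfl, rfl, Or.inl rfl, ?_, ?_⟩⟩
    · rintro b - (h | h)
      · exact absurd h (Set.notMem_empty _)
      · exact hO b h
    · rintro rfl (h | h)
      · exact absurd h (Set.notMem_empty _)
      · exact absurd h not_mk_lic_mk
    · rintro (h | h)
      · exact absurd h (Set.notMem_empty _)
      · rcases Ballot.mk_lt_mk.1 h.1 with h | ⟨h, -⟩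
        · exact not_lt_one h
        · exact absurd h (by decide)
  · intro h
    rw [← hzx (Ballot.mk_inj.1 h).2]
    rfl
  · intro n hn h
    rw [← (Ballot.mk_inj.1 h).1] at hn
    exact absurd hn (lt_irrefl _)
  · intro _ y hy
    obtain rfl : x₀ = y := Option.some_inj.1 hy
    refine ⟨fun hle b hb => hO b (hone hle b hb), fun h => ?_⟩
    rw [← hzx h]
    rfl
  · intro h
    exact absurd rfl h
  · intro h
    cases h
  · simp only [List.mem_singleton, forall_eq]
    rintro _ ⟨k, hk, hb, b', hb', rfl⟩
    rcases hz with rfl | rfl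
    · exact hO b' (hb b' hb')
    · rcases (one_le : 1 ≤ k).lt_or_eq with h1 | rfl
      · rw [← Ballot.Covers.value_eq h1 hb]
        have := hb b' hb'
        rw [Ballot.Covers.value_eq h1 hb] at this ⊢
        exact hO b' this
      · exact hO b' hb'
  · intro hw
    rw [hzI hw]
    rfl

theorem Loc.matches_ready (hL : Loc S x w P s t) (hs : s.Active) {O D}
    (h₁ : LSteps S w t [] O { t with readied := t.readied ∪ D })
    (h₂ : LocA x (P ∪ O) { t with readied := t.readied ∪ D }) {m : CMsg X}
    (h₃ : img x m ⊆ P ∪ O) (h₄ : s'.started = true) (h₅ : s'.stopped = s.stopped)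
    (h₆ : s'.maxVotedPrep = s.maxVotedPrep) (h₇ : s'.candidate = s.candidate)
    (h₈ : s'.prepared = s.prepared) (h₉ : s'.recv = s.recv) (ht : s'.timer = s.timer)
    (hr : s'.round = s.round) : Matches S I x w P t [] [m] s' := by
  refine ⟨_, _, _, h₁, ?_, by simpa using h₃, fun _ => rfl⟩
  refine hL.update Set.subset_union_left h₄ h₂ (hL.active hs).1
    (fun h => h₅.trans (hL.stopped h)) rfl h₆ h₇ h₈ h₉ fun h => ?_
  rw [hr, h₉]
  exact hL.timer (ht ▸ h)

/-- The abstract node reacts only if a commit vote with value `x` is really sent. Other changes of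
the concrete `prepared` go unmatched; the abstract one catches up at such a vote or at the timeout.
-/
theorem Loc.matches_commit (hL : Loc S x w P s t) (hh : Heard x s t) (hs : s.Active)
    {b : Ballot X} (hb : s.PrepQuorum S w .ready b) (h0 : ⊥ < b) :
    Matches S I x w P t [.prepared w b, .commit w b]
      (({ s with maxDeliveredPrep := b, prepared := b, candidate := b } :
        CState V X).doCommit b).2
      (({ s with maxDeliveredPrep := b, prepared := b, candidate := b } :
        CState V X).doCommit b).1 := by
  have ht := hL.active hs
  have hA := hL.abs hs.1
  have hupd : ∀ {P' t'} (s' : CState V X), LocA x P' t' → t'.started = true → t'.stopped = t.stopped →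
      t'.candidate = t.candidate → s'.started = s.started → s'.stopped = s.stopped →
      s'.maxVotedPrep = s.maxVotedPrep → s'.prepared = b → s'.recv = s.recv →
      s'.timer = s.timer → s'.round = s.round → Loc S x w P' s' t' := by
    intro P' t' s' hA' h1 h2 h3 h4 h5 h6 h7 h8 h9 h10
    refine hL.update_prepared (h4.trans hs.1) hA' h1 (fun h => ?_) h3 h6 (by rw [h7]; exact h0.ne')
      ?_ h8 h9 h10
    · rw [h2] at h
      rw [h5, hL.stopped h]
    · rw [h7]
      exact hb.of_recv fun u => by rw [h8]
  unfold CState.doCommit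
  split_ifs with hif
  · have hm : s.maxVotedPrep = b := hif.2
    by_cases hx : ∃ n, b = .mk n x
    · obtain ⟨n, rfl⟩ := hx
      -- The vote is for the highest ballot voted to prepare, which determines the abstract
      -- candidate.
      have hc : t.candidate = .mk (min n 2) x := by
        rcases (one_le : 1 ≤ n).lt_or_eq with hn | rfl
        · have h2 : 2 ≤ n := PNat.add_one_le_iff.2 hn
          rw [min_eq_right h2]
          exact hL.voted_two n hn hm
        · exact hL.voted_one hm
      have hk : min n 2 ≤ 2 := min_le_right _ _
      have hcov : (Ballot.mk n x).Covers (.mk (min n 2) x) :=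
        Ballot.covers_mk_mono (min_le_left _ _) x
      obtain ⟨U, hU, hw, hf⟩ := hb
      obtain ⟨H₁, D, hs₁, hsil₁, hA₁, hab⟩ := hA.deliver (S := S) (w := w) ht hk
        ⟨U, hU, hw, fun b' hb' => hh.readyPrep hf hk hcov hb'⟩
      obtain ⟨H₂, O, t', hs₂, hsil₂, hA₂, hc₂, h3, h4, hv⟩ := hA₁.voteTrue (S := S) (w := w) ht hk hc hab
      refine ⟨_, _, _, hs₁.trans hs₂, ?_, ?_, fun _ => hsil₁.append hsil₂⟩
      · rw [Set.empty_union]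
        exact hupd _ hA₂ (h3.trans ht.1) h4 hc₂ rfl rfl rfl rfl rfl rfl rfl
      · simp only [List.mem_singleton, forall_eq]
        rintro _ ⟨m, hm, rfl⟩
        rw [← (Ballot.mk_inj.1 hm).1, Set.empty_union]
        exact hv
    · refine ⟨_, _, _, LSteps.nil t, ?_, ?_, fun _ => rfl⟩
      · rw [Set.union_empty]
        exact hupd _ hA ht.1 rfl rfl rfl rfl rfl rfl rfl rfl rfl
      · simp only [List.mem_singleton, forall_eq]
        rintro _ ⟨m, hm, rfl⟩
        exact absurd ⟨m, hm⟩ hx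
  · refine ⟨_, _, _, LSteps.nil t, ?_, by simp, fun _ => rfl⟩
    rw [Set.union_empty]
    exact hupd _ hA ht.1 rfl rfl rfl rfl rfl rfl rfl rfl rfl

/-- The abstract node moves to `⟨2, x⟩` even for some `y > x`: a node that proposed a value below
`x` may still owe the rejections for `⟨1, x⟩`, and a prepared ballot with value `y` provides what is
needed to prepare `⟨1, x⟩` and move on with `x`. When it does not move, the image of the vote has
been sent before or is empty. -/
theorem Loc.matches_timeout (hL : Loc S x w P s t) (hh : Heard x s t) (hs : s.Active)
    (htm : s.timer = true) {y : X} (hy : NextValue s.candidate s.prepared y) :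
    Matches S I x w P t [.timeout w, .prepare w (.mk s.round.succPNat y)]
      (({ s with timer := false, candidate := .mk s.round.succPNat y } :
        CState V X).doPrepare (.mk s.round.succPNat y)).2
      (({ s with timer := false, candidate := .mk s.round.succPNat y } :
        CState V X).doPrepare (.mk s.round.succPNat y)).1 := by
  have ht := hL.active hs
  have hA := hL.abs hs.1
  obtain ⟨hround, U, hU, hw, hfrom⟩ := hL.timer htm
  have hn : 1 < s.round.succPNat := by
    rw [← PNat.coe_lt_coe, Nat.succPNat_coe]
    exact Nat.lt_succ_of_le hround
  have hcand : s.prepared = ⊥ → s.candidate.x = some y := by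
    intro hp
    rcases hy with h | h
    · exact h.2
    · exact absurd hp h.1
  have hnil : ∀ s' : CState V X, s'.started = s.started → s'.stopped = s.stopped →
      (s'.maxVotedPrep = s.maxVotedPrep ∨ s'.maxVotedPrep = .mk s.round.succPNat y ∧ y ≠ x) →
      s'.prepared = s.prepared → s'.candidate = .mk s.round.succPNat y → s'.recv = s.recv →
      s'.timer = false → Loc S x w P s' t := by
    intro s' h1 h2 h3 h4 h5 h6 h7
    refine ⟨fun h => absurd (h.symm.trans (h1.trans hs.1)) (by decide), hL.started.trans h1.symm,
      fun h => h2.trans (hL.stopped h), fun _ => hA, ?_, ?_, ?_, ?_, fun h => ?_⟩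
    · intro h
      rcases h3 with h3 | ⟨h3, hne⟩
      · exact hL.voted_one (h3 ▸ h)
      · exact absurd (Ballot.mk_inj.1 (h3.symm.trans h)).2 hne
    · intro n hn h
      rcases h3 with h3 | ⟨h3, hne⟩
      · exact hL.voted_two n hn (h3 ▸ h)
      · exact absurd (Ballot.mk_inj.1 (h3.symm.trans h)).2 hne
    · intro hp z hz
      rw [h4] at hp
      rw [h5, Ballot.x_mk] at hz
      exact hL.candidate hp z ((hcand hp).trans hz)
    · rw [h4]
      intro hp
      exact (hL.prepared hp).of_recv fun u => by rw [h6]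
    · exact absurd (h7.symm.trans h) (by decide)
  unfold CState.doPrepare
  split_ifs with hlt
  · by_cases hcase : x ≤ y ∧ (s.prepared ≠ ⊥ ∨ y = x)
    · obtain ⟨hle, hcase⟩ := hcase
      have hq : ∃ U, S.IsQuorum U ∧ w ∈ U ∧ ∀ u ∈ U, ∃ z, ∀ b : Ballot X, b.Lic (.mk 1 z) →
          AMsg.vote b false ∈ t.recv u := by
        refine ⟨U, hU, hw, fun u hu => ?_⟩
        obtain ⟨m, hm⟩ := hfrom u hu
        exact (hh u m hm).1
      obtain ⟨H, O, t', hs', hsil, hA', hc', h3, h4⟩ : ∃ H O t', LSteps S w t H O t' ∧ Silent H ∧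
          LocA x (P ∪ O) t' ∧ t'.candidate = .mk 2 x ∧ t'.started = t.started ∧
          t'.stopped = t.stopped := by
        by_cases hp : s.prepared = ⊥
        · obtain rfl := hcase.resolve_left (not_not.2 hp)
          exact hA.advance ht hq (Or.inl ((hL.candidate hp y (hcand hp)).2 rfl))
        · have hpx : s.prepared.x = some y := by
            rcases hy with h | h
            · exact absurd h.1 hp
            · exact h.2
          obtain ⟨m, hm⟩ := Ballot.eq_mk_of_x_eq hpx
          obtain ⟨U', hU', hw', hf⟩ := hL.prepared hp
          have hcov : s.prepared.Covers (.mk 1 x) := by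
            rw [hm]
            exact Ballot.covers_one_of_le hle
          obtain ⟨H₁, D, hs₁, hsil₁, hA₁, hab⟩ := hA.deliver (S := S) (w := w) (k := 1) ht (by decide)
            ⟨U', hU', hw', fun b' hb' => hh.readyPrep hf (by decide) hcov hb'⟩
          obtain ⟨H₂, O, t', hs₂, hsil₂, hA₂, h3, h4, h5⟩ := hA₁.advance (S := S) (w := w) ht hq
            (Or.inr hab)
          have hs₃ := hs₁.trans hs₂
          rw [Set.empty_union] at hs₃
          exact ⟨_, O, t', hs₃, hsil₁.append hsil₂, hA₂, h3, h4, h5⟩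
      have hP : ∀ b : Ballot X, b.Lic (.mk 2 x) → AMsg.vote b false ∈ P ∪ O := by
        intro b hb
        rcases hA'.stage with ⟨z, hz, -⟩ | ⟨-, h, -⟩
        · exact absurd (Ballot.mk_inj.1 (hz.symm.trans hc')).1 (by decide)
        · exact hA'.voted_false b hb (h b hb)
      refine ⟨H, O, t', hs', ⟨fun h => ?_, ?_, fun h => ?_, fun _ => hA', fun h => ?_, fun _ _ _ => hc',
        fun _ z hz => ⟨fun _ b hb => hP b (lic_two_of_lic (by decide) hb), fun _ => ?_⟩, fun hp => ?_,
        fun h => ?_⟩, ?_, fun _ => hsil⟩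
      · exact absurd (h.symm.trans hs.1) (by decide)
      · exact h3.trans hL.started
      · rw [h4] at h
        exact hL.stopped h
      · have h1 := (Ballot.mk_inj.1 h).1
        rw [h1] at hn
        exact absurd hn (lt_irrefl _)
      · rw [hc', Ballot.x_mk]
      · exact hL.prepared hp
      · cases h
      · simp only [List.mem_singleton, forall_eq]
        rintro _ ⟨k, hk, -, b', hb', rfl⟩
        exact hP b' (lic_two_of_lic hk hb')
    · refine ⟨_, _, _, LSteps.nil t, ?_, ?_, fun _ => rfl⟩
      · rw [Set.union_empty]
        refine hnil _ rfl rfl (Or.inr ⟨rfl, ?_⟩) rfl rfl rfl rfl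
        rintro rfl
        exact hcase ⟨le_rfl, Or.inr rfl⟩
      · simp only [List.mem_singleton, forall_eq]
        rintro _ ⟨k, hk, hb, b', hb', rfl⟩
        have hle := hb.le_value
        have hp : s.prepared = ⊥ := by
          by_contra hp
          exact hcase ⟨hle, Or.inl hp⟩
        have hk1 : k = 1 := by
          rcases (one_le : 1 ≤ k).lt_or_eq with h1 | h1
          · exact absurd ⟨hle, Or.inr (hb.value_eq h1)⟩ hcase
          · exact h1.symm
        subst hk1
        exact Or.inl ((hL.candidate hp y (hcand hp)).1 hle b' hb')
  · refine ⟨_, _, _, LSteps.nil t, ?_, by simp, fun _ => rfl⟩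
    rw [Set.union_empty]
    exact hnil _ rfl rfl (Or.inl rfl) rfl rfl rfl rfl

/-- On `I` the value is `x`, the quorum of READY messages carries over to `⟨min n 2, x⟩`, and this
ballot is undelivered because the node has not stopped. Outside `I` the decision is ignored. -/
theorem Loc.matches_committed (hL : Loc S x w P s t) (hh : Heard x s t) (hs : s.Active)
    {b : Ballot X} {x₀ : X} (hx : b.x = some x₀) (hxI : w ∈ I → x₀ = x) {U : Set V}
    (hU : S.IsQuorum U) (hw : w ∈ U) (h : s.CmtFrom .ready U b) (D : Finset (Ballot X)) :
    Matches S I x w P t [.committed w b, .decide w x₀] []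
      { s with deliveredCmt := D, stopped := true } := by
  have ht := hL.active hs
  have hA := hL.abs hs.1
  by_cases hwI : w ∈ I
  · obtain rfl := hxI hwI
    obtain ⟨n, rfl⟩ := Ballot.eq_mk_of_x_eq hx
    have h1 := LSteps.single (AAct.deliverTrue (S := S) (w := w) t (.mk (min n 2) x₀) x₀ U ht rfl
      (hA.delivered_true ht.2 _) hU hw (hh.readyCmt h))
    refine ⟨_, _, _, h1, ?_, by simp, fun _ => rfl⟩
    refine hL.update Set.subset_union_left hs.1 ?_ ht.1 (fun _ => rfl) rfl rfl rfl rfl rfl hL.timer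
    have hA' := hA.mono (P' := P ∪ {m | ∃ ms ∈ ([] : List (Batch X)), m ∈ ms}) Set.subset_union_left
    refine ⟨hA'.base, hA'.voted_false, hA'.readied_false, hA'.readied_true, ?_, ?_, hA'.stage⟩
    · rintro b hb (h | rfl)
      · exact hA'.delivered_false b hb h
      · exact absurd hb not_mk_lic_mk
    · intro h
      cases h
  · refine ⟨_, _, _, LSteps.nil t, ?_, by simp, fun h => absurd h hwI⟩
    rw [Set.union_empty]
    exact hL.update subset_rfl hs.1 hA ht.1 (fun _ => rfl) rfl rfl rfl rfl rfl hL.timer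

theorem Loc.matches_act (hL : Loc S x w P s t) (hh : s.Active → Heard x s t)
    {evs : List (CEvent V X)} {out : List (CMsg X)} (hact : CAct S w s evs out s')
    (hx : w ∈ I → ∀ y, CEvent.decide w y ∈ evs → y = x) : Matches S I x w P t evs out s' := by
  cases hact with
  | propose x₀ hs => exact hL.matches_propose hs x₀
  | readyPrepQuorum b hs hb =>
    obtain ⟨U, hU, hw, hf⟩ := hb.1.2
    obtain ⟨O, D, h1, h2, h3⟩ := (hL.abs hs.1).readyPrep (S := S) (w := w) (b := b) (hL.active hs)
      fun k hk hc b' hb' => Or.inl ⟨U, hU, hw, (hh hs).votePrep hf hk hc hb'⟩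
    exact hL.matches_ready hs h1 h2 h3 hs.1 rfl rfl rfl rfl rfl rfl rfl
  | readyPrepBlocking b hs hb =>
    obtain ⟨B, hB, hf⟩ := hb.1.2
    obtain ⟨O, D, h1, h2, h3⟩ := (hL.abs hs.1).readyPrep (S := S) (w := w) (b := b) (hL.active hs)
      fun k hk hc b' hb' => Or.inr ⟨B, hB, (hh hs).readyPrep hf hk hc hb'⟩
    exact hL.matches_ready hs h1 h2 h3 hs.1 rfl rfl rfl rfl rfl rfl rfl
  | preparedOnly b hs hb h =>
    refine ⟨_, _, _, LSteps.nil t, ?_, by simp, fun _ => rfl⟩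
    have hb0 : ⊥ < max s.prepared b := (bot_le.trans_lt hb.1.1).trans_le (le_max_right _ _)
    rw [Set.union_empty]
    refine hL.update_prepared hs.1 (hL.abs hs.1) (hL.active hs).1 hL.stopped rfl rfl hb0.ne' ?_ rfl
      rfl rfl
    change s.PrepQuorum S w .ready (max s.prepared b)
    rcases le_or_gt b s.prepared with hle | hlt
    · rw [max_eq_left hle] at hb0 ⊢
      exact hL.prepared hb0.ne'
    · rw [max_eq_right hlt.le]
      exact hb.1.2
  | preparedCommit b hs hb h =>
    exact hL.matches_commit (hh hs) hs hb.1.2 (bot_le.trans_lt hb.1.1)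
  | readyCmtQuorum b U hs hU hw h hb =>
    obtain ⟨O, D, h1, h2, h3⟩ := (hL.abs hs.1).readyCmt (S := S) (w := w) (b := b) (hL.active hs)
      fun n hn => Or.inl ⟨U, hU, hw, (hh hs).voteCmt (hn ▸ h)⟩
    exact hL.matches_ready hs h1 h2 h3 hs.1 rfl rfl rfl rfl rfl rfl rfl
  | readyCmtBlocking b B hs hB h hb =>
    obtain ⟨O, D, h1, h2, h3⟩ := (hL.abs hs.1).readyCmt (S := S) (w := w) (b := b) (hL.active hs)
      fun n hn => Or.inr ⟨B, hB, (hh hs).readyCmt (hn ▸ h)⟩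
    exact hL.matches_ready hs h1 h2 h3 hs.1 rfl rfl rfl rfl rfl rfl rfl
  | committed b x₀ U hs hbx hU hw h hb =>
    exact hL.matches_committed (hh hs) hs hbx (fun hI => hx hI x₀ (by simp)) hU hw h _
  | startTimer U β r hs hU hw h hr =>
    refine ⟨_, _, _, LSteps.nil t, ?_, by simp, fun _ => rfl⟩
    rw [Set.union_empty]
    refine hL.update subset_rfl hs.1 (hL.abs hs.1) (hL.active hs).1 hL.stopped rfl rfl rfl rfl rfl
      fun _ => ⟨?_, U, hU, hw, fun u hu => ?_⟩
    · obtain ⟨u, hu, hru⟩ := hr.1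
      change 1 ≤ r
      rw [← hru]
      exact Nat.one_le_of_lt (h u hu).1
    · obtain ⟨-, M, -, h1 | h1⟩ := h u hu
      · exact ⟨_, h1⟩
      · exact ⟨_, h1⟩
  | timeout y hs htm hy => exact hL.matches_timeout (hh hs) hs htm hy

end LocalSimulation

/-! ### Finite runs and histories -/

section Histories

/-- Finite runs, with the list of the events of each step. -/
inductive Steps {C E : Type*} (step : C → List E → C → Prop) : C → List (List E) → C → Prop
  | nil (c : C) : Steps step c [] c
  | cons {c c₁ c₂ : C} {l : List E} {L : List (List E)} (h : step c l c₁)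
      (h' : Steps step c₁ L c₂) : Steps step c (l :: L) c₂

theorem Steps.trans {C E : Type*} {step : C → List E → C → Prop} {c₁ c₂ c₃ : C}
    {L₁ L₂ : List (List E)} (h₁ : Steps step c₁ L₁ c₂) (h₂ : Steps step c₂ L₂ c₃) :
    Steps step c₁ (L₁ ++ L₂) c₃ := by
  induction h₁ with
  | nil c => exact h₂
  | cons h h' ih => exact Steps.cons h (ih h₂)

theorem Steps.isExecutionTrace {C E : Type*} {step : C → List E → C → Prop} {c₁ c₂ : C}
    {L : List (List E)} (h : Steps step c₁ L c₂) :
    IsExecutionTrace c₁ step fun i => L.getD i [] := by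
  induction h with
  | nil c => exact ⟨fun _ => c, rfl, fun _ => Or.inr ⟨rfl, rfl⟩⟩
  | @cons c c₁ c₂ l L h h' ih =>
    obtain ⟨f, h0, hf⟩ := ih
    refine ⟨fun i => Nat.casesOn i c f, rfl, fun i => ?_⟩
    cases i with
    | zero =>
      left
      change step c l (f 0)
      rwa [h0]
    | succ i => exact hf i

open Classical in
/-- The history of a finite list of events, projected to the nodes in `I`. -/
noncomputable def hist {E H : Type*} (node : E → V) (toH : E → Option H) (I : Set V) (l : List E) :
    List H :=
  (l.filter fun e => decide (node e ∈ I)).filterMap toH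

variable {E H : Type*} {node : E → V} {toH : E → Option H} {I : Set V}

theorem hist_append (l₁ l₂ : List E) :
    hist node toH I (l₁ ++ l₂) = hist node toH I l₁ ++ hist node toH I l₂ := by
  simp [hist]

theorem hist_eq_nil {l : List E} (h : ∀ e ∈ l, toH e = none) : hist node toH I l = [] := by
  rw [hist, List.filterMap_eq_nil_iff]
  exact fun e he => h e (List.mem_of_mem_filter he)

theorem hist_of_mem {l : List E} {w : V} (h : ∀ e ∈ l, node e = w) (hw : w ∈ I) :
    hist node toH I l = l.filterMap toH := by
  classical
  rw [hist, List.filter_eq_self.2]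
  intro e he
  simpa [h e he] using hw

theorem hist_of_notMem {l : List E} {w : V} (h : ∀ e ∈ l, node e = w) (hw : w ∉ I) :
    hist node toH I l = [] := by
  rw [hist, List.filter_eq_nil_iff.2]
  · rfl
  · intro e he
    simpa [h e he] using hw

theorem hist_length_le (l : List E) : (hist node toH I l).length ≤ (l.filterMap toH).length :=
  ((List.filter_sublist).filterMap toH).length_le

theorem flatMap_range_succ (τ : Trace E) (k : ℕ) :
    (List.range (k + 1)).flatMap τ = (List.range k).flatMap τ ++ τ k := by
  simp [List.range_succ]

theorem history_project (τ : Trace E) : (τ.project node I).history toH =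
    {h | ∃ k, h <+: hist node toH I ((List.range k).flatMap τ)} := by
  unfold Trace.history Trace.project hist
  simp only [List.filter_flatMap]

theorem hist_prefix (τ : Trace E) {k m : ℕ} (hkm : k ≤ m) :
    hist node toH I ((List.range k).flatMap τ) <+: hist node toH I ((List.range m).flatMap τ) := by
  induction hkm with
  | refl => exact List.prefix_rfl
  | step _ ih =>
    rw [Nat.succ_eq_add_one, flatMap_range_succ, hist_append]
    exact ih.trans (List.prefix_append _ _)

/-- The finite prefixes stop growing at `N`, so a single list determines the history. -/
theorem history_project_of_stable (τ : Trace E) {N : ℕ}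
    (hN : ∀ k, N ≤ k → hist node toH I (τ k) = []) : (τ.project node I).history toH =
      {h | h <+: hist node toH I ((List.range N).flatMap τ)} := by
  have hst : ∀ m, N ≤ m → hist node toH I ((List.range m).flatMap τ) =
      hist node toH I ((List.range N).flatMap τ) := by
    intro m hm
    induction hm with
    | refl => rfl
    | step h ih => rw [Nat.succ_eq_add_one, flatMap_range_succ, hist_append, hN _ h, ih,
        List.append_nil]
  rw [history_project]
  ext h
  constructor
  · rintro ⟨k, hk⟩
    have := hk.trans (hist_prefix τ (le_max_left k N))
    rwa [hst _ (le_max_right k N)] at this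
  · exact fun h => ⟨N, h⟩

theorem flatMap_range_getD (L : List (List E)) :
    (List.range L.length).flatMap (fun i => L.getD i []) = L.flatten := by
  rw [← List.flatMap_id, List.flatMap_def, List.flatMap_def]
  congr 1
  refine List.ext_getElem (by simp) fun i h₁ h₂ => ?_
  have hi : i < L.length := by simpa using h₂
  simp [hi]

theorem history_getD (L : List (List E)) :
    (Trace.project node I fun i => L.getD i []).history toH =
      {h | h <+: hist node toH I L.flatten} := by
  rw [history_project_of_stable (N := L.length), flatMap_range_getD]
  intro k hk
  simp only [List.getD_eq_default _ _ hk]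
  rfl

end Histories

/-! ### Steps of ASCP -/

section AbstractSteps

/-- Every node has received the message `m` from `u`, or can receive it. -/
def Avail (a : Config V (AState V X) (Batch X)) (u : V) (m : AMsg X) : Prop :=
  ∀ w, m ∈ (a.state w).recv u ∨ ∃ ms ∈ a.chan u w, m ∈ ms

/-- The initial configuration of ASCP. -/
def aInit (V : Type u) (X : Type v) : Config V (AState V X) (Batch X) :=
  ⟨fun _ => .initial V X, fun _ _ => 0⟩

variable [LinearOrder X]

theorem AAct.recv {S : FBQS V} {w : V} {t t' : AState V X} {evs : List (AEvent V X)}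
    {out : List (Batch X)} (h : AAct S w t evs out t') : t'.recv = t.recv := by
  cases h <;> rfl

variable [Fintype V] [DecidableEq V] {S : FBQS V} {ok I : Set V}
  {a : Config V (AState V X) (Batch X)}

/-- The steps of ASCP. -/
abbrev AStep (S : FBQS V) (ok : Set V) :=
  NetStep ok (AAct S (X := X)) ARcv AEvent.sendBatch AEvent.receiveBatch

/-- An active node receives all the messages in transit to it. -/
theorem exists_steps_receive {w : V} (hw : w ∈ ok) (ha : (a.state w).Active) :
    ∃ L a' r, Steps (AStep S ok) a L a' ∧ hist AEvent.node AEvent.toH I L.flatten = [] ∧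
      a'.state = Function.update a.state w { a.state w with recv := r } ∧
      (∀ u m, Avail a u m → Avail a' u m) ∧ ∀ u m, Avail a u m → m ∈ r u := by
  -- The induction is on the number of batches in transit to `w`.
  obtain ⟨n, hn⟩ : ∃ n, ∑ u, (a.chan u w).card = n := ⟨_, rfl⟩
  induction n using Nat.strong_induction_on generalizing a with
  | _ n ih =>
    by_cases hall : ∀ u, a.chan u w = 0
    · refine ⟨[], a, (a.state w).recv, Steps.nil a, rfl, ?_, fun _ _ h => h, fun u m h => ?_⟩
      · rw [Function.update_eq_self]
      · rcases h w with h | ⟨ms, h, -⟩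
        · exact h
        · rw [hall u] at h
          exact absurd h (Multiset.notMem_zero _)
    · obtain ⟨u₀, hu₀⟩ := not_forall.1 hall
      obtain ⟨ms, hms⟩ := Multiset.exists_mem_of_ne_zero hu₀
      obtain ⟨rest, hrest⟩ := Multiset.exists_cons_of_mem hms
      set r₁ := Function.update (a.state w).recv u₀ ((a.state w).recv u₀ ∪ ms) with hr₁
      have hstep : AStep S ok a [AEvent.receiveBatch w ms u₀]
          ⟨Function.update a.state w { a.state w with recv := r₁ },
            fun x y => if x = u₀ ∧ y = w then rest else a.chan x y⟩ :=
        NetStep.receive a w u₀ ms rest _ hw hrest ⟨ha, rfl⟩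
      set a₁ : Config V (AState V X) (Batch X) :=
        ⟨Function.update a.state w { a.state w with recv := r₁ },
          fun x y => if x = u₀ ∧ y = w then rest else a.chan x y⟩ with ha₁
      have hself : a₁.state w = { a.state w with recv := r₁ } := Function.update_self _ _ _
      have hlt : ∑ u, (a₁.chan u w).card < n := by
        rw [← hn]
        refine Finset.sum_lt_sum (fun u _ => ?_) ⟨u₀, Finset.mem_univ _, ?_⟩
        · simp only [ha₁, and_true]
          split_ifs with h
          · rw [h, hrest, Multiset.card_cons]
            exact Nat.le_succ _
          · exact le_rfl
        · simp only [ha₁, and_self, if_true]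
          rw [hrest, Multiset.card_cons]
          exact Nat.lt_succ_self _
      have hmono : ∀ u m, Avail a u m → Avail a₁ u m := by
        intro u m h v
        rcases h v with h | ⟨ms', h, hm⟩
        · left
          by_cases hv : v = w
          · subst hv
            rw [hself]
            by_cases hu : u = u₀
            · subst hu
              simp [hr₁, h]
            · simpa [hr₁, hu] using h
          · simpa [ha₁, hv] using h
        · by_cases huv : u = u₀ ∧ v = w
          · obtain ⟨rfl, rfl⟩ := huv
            rw [hrest, Multiset.mem_cons] at h
            rcases h with rfl | h
            · left
              rw [hself]
              simp [hr₁, hm]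
            · right
              exact ⟨ms', by simpa [ha₁] using h, hm⟩
          · right
            exact ⟨ms', by simpa only [ha₁, if_neg huv] using h, hm⟩
      obtain ⟨L, a₂, r, h1, h2, h3, h4, h5⟩ := ih _ hlt (a := a₁) (by rw [hself]; exact ha) rfl
      refine ⟨_, a₂, r, Steps.cons hstep h1, ?_, ?_, fun u m h => h4 u m (hmono u m h),
        fun u m h => h5 u m (hmono u m h)⟩
      · rw [List.flatten_cons, hist_append, h2, List.append_nil]
        exact hist_eq_nil (by simp [AEvent.toH])
      · rw [h3, hself, ha₁]
        exact Function.update_idem _ _ _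

/-- A sequence of local actions of a correct node is a run. -/
theorem LSteps.exists_steps {w : V} (hw : w ∈ ok) {t t' : AState V X} {H : List (AEvent V X)}
    {O : Set (AMsg X)} (h : LSteps S w t H O t') (ha : a.state w = t) :
    ∃ L a', Steps (AStep S ok) a L a' ∧
      hist AEvent.node AEvent.toH I L.flatten = hist AEvent.node AEvent.toH I H ∧
      a'.state = Function.update a.state w t' ∧ (∀ u m, Avail a u m → Avail a' u m) ∧
      ∀ m ∈ O, Avail a' w m := by
  induction h generalizing a with
  | nil t =>
    refine ⟨[], a, Steps.nil a, rfl, ?_, fun _ _ h => h, fun m hm => absurd hm (Set.notMem_empty m)⟩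
    rw [← ha, Function.update_eq_self]
  | @cons t t₁ t₂ evs H out O h h' ih =>
    subst ha
    set a₁ : Config V (AState V X) (Batch X) := ⟨Function.update a.state w t₁,
      fun x y => if x = w then a.chan x y + (out : Multiset (Batch X)) else a.chan x y⟩ with ha₁
    have hstep : AStep S ok a _ a₁ := NetStep.action a w evs out t₁ hw h
    have hmono : ∀ u m, Avail a u m → Avail a₁ u m := by
      intro u m hm v
      rcases hm v with hm | ⟨ms, hms, hm⟩
      · left
        by_cases hv : v = w
        · subst hv
          simpa [ha₁, h.recv] using hm
        · simpa [ha₁, hv] using hm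
      · right
        refine ⟨ms, ?_, hm⟩
        simp only [ha₁]
        split_ifs
        · exact Multiset.mem_add.2 (Or.inl hms)
        · exact hms
    have hout : ∀ ms ∈ out, ∀ m ∈ ms, Avail a₁ w m := by
      intro ms hms m hm v
      right
      exact ⟨ms, by simp [ha₁, hms], hm⟩
    obtain ⟨L, a₂, h1, h2, h3, h4, h5⟩ := ih (a := a₁) (Function.update_self _ _ _)
    refine ⟨_, a₂, Steps.cons hstep h1, ?_, ?_, fun u m hm => h4 u m (hmono u m hm), ?_⟩
    · rw [List.flatten_cons, hist_append, h2, hist_append, hist_append,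
        hist_eq_nil (l := List.flatMap _ _), List.append_nil]
      intro e he
      simp only [List.mem_flatMap, List.mem_map] at he
      obtain ⟨m, -, w', -, rfl⟩ := he
      rfl
    · rw [h3, ha₁]
      exact Function.update_idem _ _ _
    · rintro m (⟨ms, hms, hm⟩ | hm)
      · exact h4 w m (hout ms hms m hm)
      · exact h5 m hm

/-- Faulty nodes can send all messages at the start. -/
theorem exists_steps_faulty (l : List (V × V)) (hl : ∀ p ∈ l, p.1 ∉ ok)
    (a : Config V (AState V X) (Batch X)) :
    ∃ L a', Steps (AStep S ok) a L a' ∧ L.flatten = [] ∧ a'.state = a.state ∧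
      (∀ u v, ∀ ms ∈ a.chan u v, ms ∈ a'.chan u v) ∧ ∀ p ∈ l, Set.univ ∈ a'.chan p.1 p.2 := by
  induction l generalizing a with
  | nil => exact ⟨[], a, Steps.nil a, rfl, rfl, fun _ _ _ h => h, by simp⟩
  | cons p l ih =>
    -- The batch of all messages, contradictory ones included, exempts every later step of a faulty
    -- node from being matched.
    have hstep : AStep S ok a _ _ := NetStep.faulty a p.1 p.2 Set.univ (hl p List.mem_cons_self)
    obtain ⟨L, a', h1, h2, h3, h4, h5⟩ := ih (fun q hq => hl q (List.mem_cons_of_mem _ hq)) _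
    refine ⟨_, a', Steps.cons hstep h1, by simpa using h2, h3, fun u v ms hms => h4 u v ms ?_, ?_⟩
    · simp only
      split_ifs
      · exact Multiset.mem_cons_of_mem hms
      · exact hms
    · intro q hq
      rcases List.mem_cons.1 hq with rfl | hq
      · exact h4 _ _ _ (by simp)
      · exact h5 q hq

end AbstractSteps

/-! ### The simulation -/

section Simulation

variable [LinearOrder X]

theorem Loc.mono {S : FBQS V} {x : X} {w : V} {P P' : Set (AMsg X)} {s : CState V X}
    {t : AState V X} (h : Loc S x w P s t) (hP : P ⊆ P') : Loc S x w P' s t :=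
  { h with
    abs := fun hs => (h.abs hs).mono hP
    candidate := fun hp y hy =>
      ⟨fun hxy b hb => hP ((h.candidate hp y hy).1 hxy b hb), (h.candidate hp y hy).2⟩ }

theorem Loc.receive_concrete {S : FBQS V} {x : X} {w : V} {P : Set (AMsg X)} {s : CState V X}
    {t : AState V X} (h : Loc S x w P s t) {r : V → Set (CMsg X)} (hr : ∀ u, s.recv u ⊆ r u)
    (hact : ¬ s.Active → r = s.recv) : Loc S x w P { s with recv := r } t :=
  { h with
    init := fun hs => by
      have hs : s.started = false := hs
      rw [hact fun ha => absurd (ha.1.symm.trans hs) (by decide)]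
      exact h.init hs
    prepared := fun hp => (h.prepared hp).of_recv hr
    timer := fun ht => by
      obtain ⟨h1, U, hU, hw, h2⟩ := h.timer ht
      refine ⟨h1, U, hU, hw, fun u hu => ?_⟩
      obtain ⟨m, hm⟩ := h2 u hu
      exact ⟨m, hr u hm⟩ }

theorem Loc.receive_abstract {S : FBQS V} {x : X} {w : V} {P : Set (AMsg X)} {s : CState V X}
    {t : AState V X} (h : Loc S x w P s t) (hs : s.Active) (r : V → Set (AMsg X)) :
    Loc S x w P s { t with recv := r } :=
  { h with
    init := fun hs' => absurd (hs.1.symm.trans hs') (by decide)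
    abs := fun hs' => { h.abs hs' with } }

theorem CAct.node {S : FBQS V} {w : V} {s s' : CState V X} {evs : List (CEvent V X)}
    {out : List (CMsg X)} (h : CAct S w s evs out s') : ∀ e ∈ evs, e.node = w := by
  cases h <;> simp [CEvent.node]

/-- The relation between concrete and abstract configurations. -/
structure Sim (S : FBQS V) (ok : Set V) (x : X) (c : Config V (CState V X) (CMsg X))
    (a : Config V (AState V X) (Batch X)) : Prop where
  faulty : ∀ u ∉ ok, ∀ m, Avail a u m
  -- Only this inclusion is needed; more messages may be available in the abstract run.
  sent : ∀ u m, CSent c u m →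
    (∃ y, ∀ b : Ballot X, b.Lic (.mk 1 y) → Avail a u (.vote b false)) ∧
      ∀ m' ∈ img x m, Avail a u m'
  loc : ∀ w ∈ ok, Loc S x w {m | Avail a w m} (c.state w) (a.state w)

variable [Fintype V] [DecidableEq V] {S : FBQS V} {ok I : Set V} {x : X}
  {c c' : Config V (CState V X) (CMsg X)} {a : Config V (AState V X) (Batch X)}

/-- Receptions are not matched one by one: the abstract node catches up just before it acts. A node
that has not proposed cannot receive, but proposing does not depend on messages. -/
theorem Sim.exists_heard (h : Sim S ok x c a) {w : V} (hw : w ∈ ok) :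
    ∃ L a', Steps (AStep S ok) a L a' ∧ hist AEvent.node AEvent.toH I L.flatten = [] ∧
      Sim S ok x c a' ∧ ((c.state w).Active → Heard x (c.state w) (a'.state w)) := by
  by_cases hs : (c.state w).Active
  · obtain ⟨L, a', r, h1, h2, h3, h4, h5⟩ :=
      exists_steps_receive (S := S) (I := I) hw ((h.loc w hw).active hs)
    refine ⟨L, a', h1, h2, ⟨fun u hu m => h4 u m (h.faulty u hu m), fun u m hm => ?_,
      fun w' hw' => ?_⟩, fun _ u m hm => ?_⟩
    · obtain ⟨⟨y, hy⟩, h6⟩ := h.sent u m hm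
      exact ⟨⟨y, fun b hb => h4 u _ (hy b hb)⟩, fun m' hm' => h4 u m' (h6 m' hm')⟩
    · have hl := (h.loc w' hw').mono (P' := {m | Avail a' w' m}) fun m hm => h4 w' m hm
      rw [h3]
      by_cases hww : w' = w
      · subst hww
        rw [Function.update_self]
        exact hl.receive_abstract hs r
      · rwa [Function.update_of_ne hww]
    · obtain ⟨⟨y, hy⟩, h6⟩ := h.sent u m ⟨w, Or.inl hm⟩
      rw [h3, Function.update_self]
      exact ⟨⟨y, fun b hb => h5 u _ (hy b hb)⟩, fun m' hm' => h5 u m' (h6 m' hm')⟩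
  · exact ⟨[], a, Steps.nil a, rfl, h, fun h' => absurd h' hs⟩

/-- Every step of CSCP in which members of `I` only decide `x` is matched by a run of ASCP. -/
theorem Sim.step (h : Sim S ok x c a) {l : List (CEvent V X)}
    (hstep : NetStep ok (CAct S) CRcv CEvent.send CEvent.receive c l c')
    (hx : ∀ w ∈ I, ∀ y, CEvent.decide w y ∈ l → y = x) :
    ∃ L a', Steps (AStep S ok) a L a' ∧ Sim S ok x c' a' ∧
      hist AEvent.node AEvent.toH I L.flatten = hist CEvent.node CEvent.toH I l := by
  rcases cStep_cases hstep with
    ⟨w, hw, evs, out, s', hact, ⟨l', rfl, hl'⟩, hst, hsent⟩ | ⟨hl, hsent, r, hst, hr, hr'⟩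
  · obtain ⟨L₁, a₁, hL₁, hh₁, hsim, hheard⟩ := h.exists_heard (I := I) hw
    obtain ⟨H, O, t', h1, h2, h3, h4⟩ := (hsim.loc w hw).matches_act (I := I) hheard hact
      fun hwI y hy => hx w hwI y (List.mem_append_left _ hy)
    obtain ⟨L₂, a₂, hL₂, hh₂, hst₂, hmono, hO⟩ := h1.exists_steps (I := I) hw rfl
    have hP : {m | Avail a₁ w m} ∪ O ⊆ {m | Avail a₂ w m} := by
      rintro m (hm | hm)
      · exact hmono w m hm
      · exact hO m hm
    have hstarted : s'.started = true := hact.spec.started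
    refine ⟨L₁ ++ L₂, a₂, hL₁.trans hL₂, ⟨fun u hu m => hmono u m (hsim.faulty u hu m),
      fun u m hm => ?_, fun w' hw' => ?_⟩, ?_⟩
    · rcases (hsent u m).1 hm with hm | ⟨rfl, hm⟩
      · obtain ⟨⟨y, hy⟩, h6⟩ := hsim.sent u m hm
        exact ⟨⟨y, fun b hb => hmono u _ (hy b hb)⟩, fun m' hm' => hmono u m' (h6 m' hm')⟩
      · obtain ⟨y, hy⟩ := (h2.abs hstarted).base
        exact ⟨⟨y, fun b hb => hP (hy b hb)⟩, fun m' hm' => hP (h3 m hm hm')⟩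
    · rw [hst, hst₂]
      by_cases hww : w' = w
      · subst hww
        rw [Function.update_self, Function.update_self]
        exact h2.mono hP
      · rw [Function.update_of_ne hww, Function.update_of_ne hww]
        exact (hsim.loc w' hw').mono fun m hm => hmono w' m hm
    · rw [List.flatten_append, hist_append, hh₁, List.nil_append, hh₂, hist_append,
        hist_eq_nil hl', List.append_nil]
      by_cases hwI : w ∈ I
      · rw [hist_of_mem h1.node hwI, hist_of_mem hact.node hwI, h4 hwI]
      · rw [hist_of_notMem h1.node hwI, hist_of_notMem hact.node hwI]
  -- Receptions and faulty steps need no abstract step: the images involved are already available.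
  · refine ⟨[], a, Steps.nil a, ⟨h.faulty, fun u m hm => ?_, fun w hw => ?_⟩, ?_⟩
    · by_cases hu : u ∈ ok
      · exact h.sent u m ((hsent u hu m).1 hm)
      · exact ⟨⟨x, fun b _ => h.faulty u hu _⟩, fun m' _ => h.faulty u hu m'⟩
    · rw [hst]
      exact (h.loc w hw).receive_concrete (hr w) (hr' w)
    · rw [hist_eq_nil hl]
      rfl

theorem exists_sim_init (S : FBQS V) (ok : Set V) (x : X) :
    ∃ L a, Steps (AStep S ok) (aInit V X) L a ∧ L.flatten = [] ∧ Sim S ok x (cInit V X) a := by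
  classical
  obtain ⟨L, a, h1, h2, h3, -, h4⟩ := exists_steps_faulty (S := S) (ok := ok)
    (Finset.univ.filter fun p : V × V => p.1 ∉ ok).toList (by simp) (aInit V X)
  refine ⟨L, a, h1, h2, ⟨fun u hu m w => Or.inr ⟨_, h4 (u, w) (by simp [hu]), Set.mem_univ m⟩,
    fun u m hm => absurd hm (not_cSent_cInit u m), fun w _ => ?_⟩⟩
  rw [h3]
  refine ⟨fun _ => ⟨rfl, rfl⟩, rfl, fun h => ?_, fun h => ?_, fun h => ?_, fun n _ h => ?_,
    fun _ y h => ?_, fun h => ?_, fun h => ?_⟩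
  · cases h
  · cases h
  · exact absurd h.symm (Ballot.mk_ne_bot _ _)
  · exact absurd h.symm (Ballot.mk_ne_bot _ _)
  · cases h
  · exact absurd rfl h
  · cases h

end Simulation

/-! ### Finiteness of histories -/

section Progress

/-- The number of proposals and decisions so far. -/
def progress [Fintype V] (c : Config V (CState V X) (CMsg X)) : ℕ :=
  ∑ w, ((c.state w).started.toNat + (c.state w).stopped.toNat)

theorem progress_le [Fintype V] (c : Config V (CState V X) (CMsg X)) :
    progress c ≤ Fintype.card V * 2 := by
  refine (Finset.sum_le_card_nsmul _ _ 2 fun w _ => ?_).trans (by simp)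
  exact Nat.add_le_add (Bool.toNat_le _) (Bool.toNat_le _)

variable [LinearOrder X]

/-- A proposal sets `started` and a decision sets `stopped`, each from `false`, and no action resets
them. -/
theorem CAct.length_add_le {S : FBQS V} {w : V} {s s' : CState V X} {evs : List (CEvent V X)}
    {out : List (CMsg X)} (h : CAct S w s evs out s') :
    (evs.filterMap CEvent.toH).length + (s.started.toNat + s.stopped.toNat) ≤
      s'.started.toNat + s'.stopped.toNat := by
  cases h with
  | propose x hs =>
    unfold CState.doPrepare
    split_ifs <;> simp [CEvent.toH, hs]
  | preparedCommit b hs hb h =>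
    unfold CState.doCommit
    split_ifs <;> simp [CEvent.toH]
  | committed b x U hs hx hU hw h hb =>
    simp only [hs.1, hs.2]
    exact le_rfl
  | timeout y hs ht hy =>
    unfold CState.doPrepare
    split_ifs <;> simp [CEvent.toH]
  | _ => simp [CEvent.toH]

theorem progress_step [Fintype V] [DecidableEq V] {S : FBQS V} {ok I : Set V}
    {c c' : Config V (CState V X) (CMsg X)} {l : List (CEvent V X)}
    (h : NetStep ok (CAct S) CRcv CEvent.send CEvent.receive c l c') :
    (hist CEvent.node CEvent.toH I l).length + progress c ≤ progress c' := by
  rcases cStep_cases h with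
    ⟨w, hw, evs, out, s', hact, ⟨l', rfl, hl'⟩, hst, -⟩ | ⟨hl, -, r, hst, -⟩
  · rw [hist_append, hist_eq_nil hl', List.append_nil, progress, progress,
      ← Finset.add_sum_erase _ _ (Finset.mem_univ w), ← Finset.add_sum_erase _ _ (Finset.mem_univ w),
      ← add_assoc]
    refine Nat.add_le_add ?_ (Finset.sum_le_sum fun u hu => ?_)
    · rw [hst, Function.update_self]
      exact (Nat.add_le_add_right (hist_length_le evs) _).trans hact.length_add_le
    · rw [hst, Function.update_of_ne (Finset.ne_of_mem_erase hu)]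
  · rw [hist_eq_nil hl, List.length_nil, zero_add, progress, progress]
    simp only [hst]
    exact le_rfl

/-- From some point on, an execution of CSCP has no propose and decide events. -/
theorem exists_history_stable [Fintype V] [DecidableEq V] {S : FBQS V} {ok : Set V} (I : Set V)
    {c : ℕ → Config V (CState V X) (CMsg X)} {τ : Trace (CEvent V X)}
    (hstep : ∀ i, NetStep ok (CAct S) CRcv CEvent.send CEvent.receive (c i) (τ i) (c (i + 1)) ∨
      (c (i + 1) = c i ∧ τ i = [])) :
    ∃ N, ∀ k, N ≤ k → hist CEvent.node CEvent.toH I (τ k) = [] := by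
  have hle : ∀ i, (hist CEvent.node CEvent.toH I (τ i)).length + progress (c i) ≤
      progress (c (i + 1)) := by
    intro i
    rcases hstep i with h | ⟨h1, h2⟩
    · exact progress_step h
    · rw [h1, h2]
      exact (Nat.zero_add _).le
  have hmono : Monotone fun i => progress (c i) :=
    monotone_nat_of_le_succ fun i => (Nat.le_add_left _ _).trans (hle i)
  have hbdd : BddAbove (Set.range fun i => progress (c i)) :=
    ⟨_, by rintro _ ⟨i, rfl⟩; exact progress_le (c i)⟩
  -- Progress is bounded, so it attains its maximum at some `N`; a later history event would exceed
  -- it.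
  obtain ⟨N, hN⟩ := Nat.sSup_mem (Set.range_nonempty _) hbdd
  refine ⟨N, fun k hk => ?_⟩
  have h1 : progress (c (k + 1)) ≤ progress (c N) := by
    have h2 := le_csSup hbdd ⟨k + 1, rfl⟩
    rwa [← hN] at h2
  have h3 : progress (c N) ≤ progress (c k) := hmono hk
  have h4 := hle k
  exact List.length_eq_zero_iff.1 (by omega)

end Progress

/-- The finite runs of CSCP in which members of `I` only decide `x` are matched by runs of ASCP. -/
theorem exists_steps_sim [LinearOrder X] [Fintype V] [DecidableEq V] {S : FBQS V} {ok I : Set V}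
    {x : X} {c : ℕ → Config V (CState V X) (CMsg X)} {τ : Trace (CEvent V X)}
    (h0 : c 0 = cInit V X)
    (hstep : ∀ i, NetStep ok (CAct S) CRcv CEvent.send CEvent.receive (c i) (τ i) (c (i + 1)) ∨
      (c (i + 1) = c i ∧ τ i = []))
    (hx : ∀ i, ∀ w ∈ I, ∀ y, CEvent.decide w y ∈ τ i → y = x) (N : ℕ) :
    ∃ L a, Steps (AStep S ok) (aInit V X) L a ∧ Sim S ok x (c N) a ∧
      hist AEvent.node AEvent.toH I L.flatten =
        hist CEvent.node CEvent.toH I ((List.range N).flatMap τ) := by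
  induction N with
  | zero =>
    obtain ⟨L, a, h1, h2, h3⟩ := exists_sim_init S ok x
    refine ⟨L, a, h1, h0 ▸ h3, ?_⟩
    rw [h2]
    rfl
  | succ N ih =>
    obtain ⟨L, a, h1, h2, h3⟩ := ih
    rw [flatMap_range_succ, hist_append]
    rcases hstep N with h | ⟨h4, h5⟩
    · obtain ⟨L', a', h4, h5, h6⟩ := h2.step h (hx N)
      refine ⟨L ++ L', a', h1.trans h4, h5, ?_⟩
      rw [List.flatten_append, hist_append, h3, h6]
    · refine ⟨L, a, h1, h4 ▸ h2, ?_⟩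
      rw [h3, h5]
      exact (List.append_nil _).symm

end SCP

/-! ### Assembly -/

theorem mainTheorem2 {V : Type*} {X : Type*} [Fintype V] [DecidableEq V] [LinearOrder X]
    (S : SCP.FBQS V) (ok I : Set V) (hI : S.IsIntact ok I)
    (τ : SCP.Trace (SCP.CEvent V X)) (hτ : SCP.IsCSCPTrace S ok τ) :
    ∃ ρ : SCP.Trace (SCP.AEvent V X), SCP.IsASCPTrace S ok ρ ∧
      (τ.project SCP.CEvent.node I).history SCP.CEvent.toH =
        (ρ.project SCP.AEvent.node I).history SCP.AEvent.toH := by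
  obtain ⟨c, h0, hstep⟩ := hτ
  obtain ⟨N, hN⟩ := SCP.exists_history_stable I hstep
  suffices h : ∃ L a, SCP.Steps (SCP.AStep S ok) (SCP.aInit V X) L a ∧
      SCP.hist SCP.AEvent.node SCP.AEvent.toH I L.flatten =
        SCP.hist SCP.CEvent.node SCP.CEvent.toH I ((List.range N).flatMap τ) by
    obtain ⟨L, a, h1, h2⟩ := h
    exact ⟨_, h1.isExecutionTrace, by
      rw [SCP.history_project_of_stable τ hN, SCP.history_getD, h2]⟩
  -- A target value is needed even if no member of `I` decides. Without values there are no history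
  -- events at all, and the empty run will do.
  by_cases hX : Nonempty X
  · obtain ⟨x, hx⟩ : ∃ x, ∀ i, ∀ w ∈ I, ∀ y, SCP.CEvent.decide w y ∈ τ i → y = x := by
      by_cases hd : ∃ i, ∃ w ∈ I, ∃ y, SCP.CEvent.decide w y ∈ τ i
      · obtain ⟨i, w, hw, x, hx⟩ := hd
        exact ⟨x, fun j u hu y hy => SCP.agreement hI h0 hstep hu hw hy hx⟩
      · exact ⟨hX.some, fun i w hw y hy => absurd ⟨i, w, hw, y, hy⟩ hd⟩
    obtain ⟨L, a, h1, -, h2⟩ := SCP.exists_steps_sim h0 hstep hx N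
    exact ⟨L, a, h1, h2⟩
  · refine ⟨[], _, SCP.Steps.nil _, ?_⟩
    have hE : IsEmpty (SCP.HEvent V X) :=
      ⟨fun e => by cases e with | propose w x => exact hX ⟨x⟩ | decide w x => exact hX ⟨x⟩⟩
    exact Subsingleton.elim _ _
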